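/- \textbf{Community attachment model.} Let $k,n,m,c\in\mathbb N$ and $p\in[0,1]$ with $c\mid n$ and $2\le k\le c\le n/k$. The distribution $F_k(n,m,c,p)$ on $k$-CNF formulas with $n$ variables and $m$ clauses is given as follows. Choose a uniformly random partition of the $n$ variables into $c$ communities of size $n/c$. Then generate $m$ clauses independently: with probability $p$ the clause is uniform among the clauses on $k$ distinct variables that all lie in a single community, and otherwise it is uniform among the clauses on $k$ variables that all lie in different communities. \textbf{CDCL.} A state of a CDCL solver consists of a trail (an ordered partial assignment in which every literal is either a decision or was forced by unit propagation, and is then stored with the clause that forced it), a clause database (initially the input formula), and possibly a clause under conflict analysis. The elementary steps are: decide a literal of an unassigned variable; propagate a unit clause; start conflict analysis from a falsified clause; resolve the conflict clause with the clause that forced one of the propagated literals it mentions; learn the conflict clause and backtrack to an earlier point of the trail; restart; delete clauses; add a resolvent of two database clauses (pre- /inprocessing). A CDCL solver is an arbitrary rule that chooses the next step from the history of the run. Its runtime on an unsatisfiable formula is the number of steps until a database clause is falsified by an initial part of the trail that contains no decision ($\infty$ if this never happens). \textbf{Theorem.} Let $k\ge 3$ and $\alpha<1/10$. There is $\lambda>0$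 such that the following holds for all sequences of parameters $n_i,m_i,c_i\in\mathbb N$, $p_i\in[0,1]$ with $c_i\mid n_i$, $k\le c_i\le n_i/k$, $n_i\to\infty$, $m_i=O(n_i)$ and $c_i=O(n_i^\alpha)$. Let $\varphi_i$ be drawn from $F_k(n_i,m_i,c_i,p_i)$. (1) With high probability, if $\varphi_i$ is unsatisfiable then every CDCL solver has runtime at least $2^{n_i^\lambda}$ on it; that is, \[ \Pr\bigl[\varphi_i \text{ is unsatisfiable and some CDCL solver has runtime less than } 2^{n_i^{\lambda}} \text{ on } \varphi_i\bigr]\to 0 \quad (i\to\infty). \] (2) Consequently, if $\Pr[\varphi_i\text{ is unsatisfiable}]$ is bounded away from $0$ for all large $i$, then \[ \Pr\bigl[\text{every CDCL solver has runtime at least } 2^{n_i^{\lambda}} \text{ on } \varphi_i \;\big|\; \varphi_i \text{ is unsatisfiable}\bigr]\to 1. \] -/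

import Mathlib

open scoped ENNReal

noncomputable section

namespace CommunitySAT

/-! ### Clauses and CNF formulas -/

/-- A literal: a variable together with a polarity (`true` = positive, `false` = negated). -/
abbrev Lit (V : Type) := V × Bool

/-- The complementary literal. -/
def Lit.neg {V : Type} (l : Lit V) : Lit V := (l.1, !l.2)

/-- A clause is a finite set of literals, read as their disjunction. -/
abbrev Clause (V : Type) := Finset (Lit V)

/-- A set of clauses, read as their conjunction, is satisfiable. -/
def Satisfiable {V : Type} (F : Set (Clause V)) : Prop :=
  ∃ σ : V → Bool, ∀ C ∈ F, ∃ l ∈ C, σ l.1 = l.2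

/-- The resolvent of `C` (containing `l`) and `D` (containing the complement of `l`) on the
variable of `l`. -/
def resolventOn {V : Type} [DecidableEq V] (C D : Clause V) (l : Lit V) : Clause V :=
  C.erase l ∪ D.erase l.neg

/-! ### Conflict-driven clause learning

CDCL is modelled as the usual transition system on solver states. All heuristic choices (which
variable to branch on and with which polarity, when to propagate, how far to resolve during conflict
analysis, where to backtrack to, when to restart, which clauses to discard) are left open; a
solver is a policy that resolves them. -/

/-- An entry of the trail: an assigned literal, together with the clause that forced it by unit
propagation (`some R`), or `none` if the literal is a decision. -/
structure TrailEntry (V : Type) where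
  lit : Lit V
  reason : Option (Clause V)

/-- A state of a CDCL solver. -/
structure State (V : Type) where
  /-- The current partial assignment, most recent entry first. -/
  trail : List (TrailEntry V)
  /-- The clause database: input clauses and learned clauses. -/
  db : Set (Clause V)
  /-- The clause currently being processed by conflict analysis, if any. -/
  conflict : Option (Clause V)

/-- `l` is made true by the trail `T`. -/
def AssignedTrue {V : Type} (T : List (TrailEntry V)) (l : Lit V) : Prop :=
  ∃ e ∈ T, e.lit = l

/-- The variable of `l` is assigned by the trail `T`. -/
def Assigned {V : Type} (T : List (TrailEntry V)) (l : Lit V) : Prop :=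
  AssignedTrue T l ∨ AssignedTrue T l.neg

/-- All literals of `C` are made false by the trail `T`. -/
def Falsified {V : Type} (T : List (TrailEntry V)) (C : Clause V) : Prop :=
  ∀ l ∈ C, AssignedTrue T l.neg

/-- The elementary steps of a CDCL solver. -/
inductive Step {V : Type} [DecidableEq V] : State V → State V → Prop
  /-- Branch on an unassigned variable, with either polarity. -/
  | decide (T : List (TrailEntry V)) (F : Set (Clause V)) (l : Lit V) (hl : ¬ Assigned T l) :
      Step ⟨T, F, none⟩ ⟨⟨l, none⟩ :: T, F, none⟩
  /-- Unit propagation: the only literal of `C` that is not falsified is made true. -/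
  | propagate (T : List (TrailEntry V)) (F : Set (Clause V)) (C : Clause V) (l : Lit V)
      (hC : C ∈ F) (hlC : l ∈ C) (hl : ¬ Assigned T l) (hT : Falsified T (C.erase l)) :
      Step ⟨T, F, none⟩ ⟨⟨l, some C⟩ :: T, F, none⟩
  /-- A falsified clause is detected; conflict analysis starts from it. -/
  | conflict (T : List (TrailEntry V)) (F : Set (Clause V)) (C : Clause V)
      (hC : C ∈ F) (hT : Falsified T C) :
      Step ⟨T, F, none⟩ ⟨T, F, some C⟩
  /-- One step of conflict analysis: resolve the current conflict clause with the clause that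
  forced one of the propagated literals which it mentions. -/
  | explain (T : List (TrailEntry V)) (F : Set (Clause V)) (C R : Clause V) (l : Lit V)
      (hl : (⟨l, some R⟩ : TrailEntry V) ∈ T) (hlC : l.neg ∈ C) :
      Step ⟨T, F, some C⟩ ⟨T, F, some (resolventOn R C l)⟩
  /-- Learn the conflict clause and backtrack to an earlier point of the trail. -/
  | learn (T T' : List (TrailEntry V)) (F : Set (Clause V)) (C : Clause V) (hT : T' <:+ T) :
      Step ⟨T, F, some C⟩ ⟨T', insert C F, none⟩
  /-- Restart (fully or partially). -/
  | restart (T T' : List (TrailEntry V)) (F : Set (Clause V)) (hT : T' <:+ T) :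
      Step ⟨T, F, none⟩ ⟨T', F, none⟩
  /-- Discard any clauses from the database. -/
  | forget (T : List (TrailEntry V)) (F F' : Set (Clause V)) (hF : F' ⊆ F) :
      Step ⟨T, F, none⟩ ⟨T, F', none⟩
  /-- Preprocessing or inprocessing: add a clause obtained from the database by resolution. -/
  | inprocess (T : List (TrailEntry V)) (F : Set (Clause V)) (C D : Clause V) (l : Lit V)
      (hC : C ∈ F) (hD : D ∈ F) (hlC : l ∈ C) (hlD : l.neg ∈ D) :
      Step ⟨T, F, none⟩ ⟨T, insert (resolventOn C D l) F, none⟩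

/-- The formula has been found unsatisfiable: some clause of the database is falsified at decision
level zero, i.e. by an initial part of the trail that contains no decision. -/
def State.Refuted {V : Type} (s : State V) : Prop :=
  ∃ T : List (TrailEntry V), T <:+ s.trail ∧ (∀ e ∈ T, e.reason ≠ none) ∧
    ∃ C ∈ s.db, Falsified T C

/-- The initial state on input `F`: nothing is assigned and the database is `F`. -/
def State.init {V : Type} (F : Set (Clause V)) : State V := ⟨[], F, none⟩

/-- A CDCL solver: an arbitrary rule that, given all the states visited so far (most recent first),
selects the next step or stops. The only requirement is that it makes CDCL steps. -/
structure Solver (V : Type) [DecidableEq V] where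
  next : List (State V) → Option (State V)
  legal : ∀ (s : State V) (h : List (State V)) (s' : State V), next (s :: h) = some s' → Step s s'

/-- The states visited by the solver on input `F` within the first `t` steps, most recent first. -/
def Solver.history {V : Type} [DecidableEq V] (S : Solver V) (F : Set (Clause V)) :
    ℕ → List (State V)
  | 0 => [State.init F]
  | t + 1 =>
    match S.next (S.history F t) with
    | some s => s :: S.history F t
    | none => S.history F t

/-- The runtime of the solver on an unsatisfiable input `F`: the number of steps it makes until it
has established unsatisfiability (`⊤` if it never does). -/
def Solver.runtime {V : Type} [DecidableEq V] (S : Solver V) (F : Set (Clause V)) : ℕ∞ :=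
  ⨅ (t : ℕ) (_ : ∃ s ∈ S.history F t, s.Refuted), (t : ℕ∞)

/-! ### The community attachment model -/

/-- The conditions on the parameters of the community attachment model. -/
structure Admissible (k n c : ℕ) : Prop where
  dvd : c ∣ n
  two_le : 2 ≤ k
  le_c : k ≤ c
  le_n : c * k ≤ n

/-- `f` assigns the variables to `c` communities, all of size `n / c`. -/
def IsPartition {n c : ℕ} (f : Fin n → Fin c) : Prop :=
  ∀ i : Fin c, Nat.card {v : Fin n // f v = i} = n / c

/-- Partitions of the `n` variables into `c` (numbered) communities of equal size. -/
abbrev Communities (n c : ℕ) := {f : Fin n → Fin c // IsPartition f}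

/-- A clause with `k` literals on `k` different variables. -/
def IsKClause (k : ℕ) {n : ℕ} (C : Clause (Fin n)) : Prop :=
  C.card = k ∧ ∀ l ∈ C, ∀ l' ∈ C, l.1 = l'.1 → l = l'

/-- The `k`-clauses whose variables all lie in a single community. -/
abbrev WithinClause (k : ℕ) {n c : ℕ} (f : Fin n → Fin c) :=
  {C : Clause (Fin n) // IsKClause k C ∧ ∃ i, ∀ l ∈ C, f l.1 = i}

/-- The `k`-clauses whose variables all lie in different communities. -/
abbrev BridgeClause (k : ℕ) {n c : ℕ} (f : Fin n → Fin c) :=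
  {C : Clause (Fin n) // IsKClause k C ∧ ∀ l ∈ C, ∀ l' ∈ C, f l.1 = f l'.1 → l.1 = l'.1}

lemma Admissible.nonempty_communities {k n c : ℕ} (h : Admissible k n c) :
    Nonempty (Communities n c) := by
  obtain ⟨d, hd⟩ := h.dvd
  have hc : 0 < c := by have := h.two_le; have := h.le_c; omega
  subst hd
  refine ⟨⟨fun v => (finProdFinEquiv.symm v).1, fun i => ?_⟩⟩
  rw [Nat.mul_div_cancel_left _ hc]
  have e : {v : Fin (c * d) // (finProdFinEquiv.symm v).1 = i} ≃ Fin d :=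
    { toFun := fun v => (finProdFinEquiv.symm v.1).2
      invFun := fun j => ⟨finProdFinEquiv (i, j), by simp⟩
      left_inv := by
        rintro ⟨v, hv⟩
        apply Subtype.ext
        apply finProdFinEquiv.symm.injective
        rw [Equiv.symm_apply_apply]
        exact Prod.ext hv.symm rfl
      right_inv := fun j => by simp }
  rw [Nat.card_congr e, Nat.card_eq_fintype_card, Fintype.card_fin]

/-- The clause consisting of the positive literals of the variables `g 0, …, g (k - 1)`. -/
lemma exists_kClause {n k : ℕ} (g : Fin k → Fin n) (hg : Function.Injective g) :
    ∃ C : Clause (Fin n), IsKClause k C ∧ ∀ l ∈ C, ∃ j, g j = l.1 := by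
  classical
  refine ⟨Finset.univ.image fun j => (g j, true), ⟨?_, ?_⟩, ?_⟩
  · rw [Finset.card_image_of_injective _ fun a b hab => hg (congrArg Prod.fst hab)]
    simp
  · intro l hl l' hl' e
    obtain ⟨j, -, rfl⟩ := Finset.mem_image.1 hl
    obtain ⟨j', -, rfl⟩ := Finset.mem_image.1 hl'
    exact Prod.ext e rfl
  · intro l hl
    obtain ⟨j, -, rfl⟩ := Finset.mem_image.1 hl
    exact ⟨j, rfl⟩

lemma Admissible.nonempty_within {k n c : ℕ} (h : Admissible k n c) (f : Communities n c) :
    Nonempty (WithinClause k f.1) := by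
  have hc : 0 < c := by have := h.two_le; have := h.le_c; omega
  let i : Fin c := ⟨0, hc⟩
  have hk : k ≤ Nat.card {v : Fin n // f.1 v = i} := by
    rw [f.2 i, Nat.le_div_iff_mul_le hc, mul_comm]
    exact h.le_n
  let e := Finite.equivFin {v : Fin n // f.1 v = i}
  obtain ⟨C, hC, hC'⟩ := exists_kClause (fun j : Fin k => (e.symm (Fin.castLE hk j)).1)
    (fun a b hab => Fin.castLE_injective hk (e.symm.injective (Subtype.ext hab)))
  refine ⟨⟨C, hC, i, fun l hl => ?_⟩⟩
  obtain ⟨j, hj⟩ := hC' l hl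
  rw [← hj]
  exact (e.symm (Fin.castLE hk j)).2

lemma Admissible.nonempty_bridge {k n c : ℕ} (h : Admissible k n c) (f : Communities n c) :
    Nonempty (BridgeClause k f.1) := by
  have hc : 0 < c := by have := h.two_le; have := h.le_c; omega
  have hs : ∀ i : Fin c, ∃ v, f.1 v = i := by
    intro i
    have hk : 0 < Nat.card {v : Fin n // f.1 v = i} := by
      rw [f.2 i]
      exact Nat.div_pos (by nlinarith [h.le_n, h.two_le]) hc
    obtain ⟨⟨v, hv⟩⟩ := (Nat.card_pos_iff.1 hk).1
    exact ⟨v, hv⟩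
  choose g hg using hs
  have hinj : Function.Injective g := fun a b hab => by rw [← hg a, ← hg b, hab]
  obtain ⟨C, hC, hC'⟩ := exists_kClause (fun j : Fin k => g (Fin.castLE h.le_c j))
    (hinj.comp (Fin.castLE_injective _))
  refine ⟨⟨C, hC, fun l hl l' hl' e => ?_⟩⟩
  obtain ⟨j, hj⟩ := hC' l hl
  obtain ⟨j', hj'⟩ := hC' l' hl'
  rw [← hj, ← hj', hg, hg] at e
  rw [← hj, ← hj', e]

/-- The mixture of two distributions: with probability `p` sample from `μ`, otherwise from `ν`. -/
def mixture {α : Type} (p : unitInterval) (μ ν : PMF α) : PMF α :=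
  ⟨fun a => ENNReal.ofReal p * μ a + ENNReal.ofReal (1 - p) * ν a, by
    have h : ∑' a, (ENNReal.ofReal p * μ a + ENNReal.ofReal (1 - p) * ν a) = 1 := by
      rw [ENNReal.tsum_add, ENNReal.tsum_mul_left, ENNReal.tsum_mul_left, μ.tsum_coe, ν.tsum_coe,
        mul_one, mul_one, ← ENNReal.ofReal_add p.2.1 (sub_nonneg.2 p.2.2)]
      simp
    exact h ▸ ENNReal.summable.hasSum⟩

/-- The distribution of `m` independent samples from `μ`. -/
def iid {α : Type} [Fintype α] (μ : PMF α) (m : ℕ) : PMF (Fin m → α) :=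
  PMF.ofFintype (fun φ => ∏ j, μ (φ j)) (by
    classical
    rw [← Fintype.prod_sum]
    have h : ∑ a, μ a = 1 := by rw [← tsum_fintype (L := .unconditional α)]; exact μ.tsum_coe
    simp [h])

/-- One random clause, for given communities: with probability `p` uniform among the clauses within
a community, otherwise uniform among the bridge clauses. -/
def randomClause {k n c : ℕ} (h : Admissible k n c) (p : unitInterval) (f : Communities n c) :
    PMF (Clause (Fin n)) :=
  haveI : Fintype (WithinClause k f.1) := Fintype.ofFinite _
  haveI : Fintype (BridgeClause k f.1) := Fintype.ofFinite _
  haveI := h.nonempty_within f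
  haveI := h.nonempty_bridge f
  mixture p ((PMF.uniformOfFintype (WithinClause k f.1)).map Subtype.val)
    ((PMF.uniformOfFintype (BridgeClause k f.1)).map Subtype.val)

/-- The community attachment model `F_k(n, m, c, p)`: choose a uniformly random partition of the
`n` variables into `c` communities, then generate `m` clauses independently. -/
def communityAttachment {k n c : ℕ} (h : Admissible k n c) (m : ℕ) (p : unitInterval) :
    PMF (Fin m → Clause (Fin n)) :=
  haveI : Fintype (Communities n c) := Fintype.ofFinite _
  haveI := h.nonempty_communities
  (PMF.uniformOfFintype (Communities n c)).bind fun f => iid (randomClause h p f) m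

/-! ### The events -/

/-- The event that a formula with `m` clauses on `n` variables is unsatisfiable. -/
def unsatEvent (n m : ℕ) : Set (Fin m → Clause (Fin n)) :=
  {φ | ¬ Satisfiable (Set.range φ)}

/-- The event that every CDCL solver makes at least `B` steps on the formula. The solver is
quantified inside the event, so its rule may depend on the formula in any way. -/
def hardEvent (n m : ℕ) (B : ℝ) : Set (Fin m → Clause (Fin n)) :=
  {φ | ∀ S : Solver (Fin n), ENNReal.ofReal B ≤ (S.runtime (Set.range φ) : ℝ≥0∞)}

end CommunitySAT

end

/-!
The runtime bound is a size lower bound for resolution. A run of `t` steps that refutes the formula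
contains a resolution refutation of at most `2 * t` lines (`Solver.exists_derivation`): each step
adds at most one resolvent, and each entry of the final, decision-free trail costs one more
resolution step. Resolution is treated semantically: a line has to be entailed by two earlier ones.
This makes derivations stable under restrictions without any syntactic bookkeeping.

By the size-width relation of Ben-Sasson and Wigderson (`widthClosure_of_derivation`), a refutation
with fewer than `exp (d ^ 2 / 2n)` lines gives one of width `2 * d`. On the other hand, a formula
is hard for width of order `r` if every set of `s ≤ r` of its clauses has a boundary of order `s`,
that is, this many variables that occur in exactly one of the clauses (`BoundaryExpanding`). A
minimal set of clauses entailing a clause `C` has its boundary inside `C`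
(`boundary_subset_vars`), and since the size of such a set at most doubles in an inference, some
clause of the refutation needs between `r / 2` and `r` of the input clauses and is therefore wide
(`BoundaryExpanding.not_widthClosure_empty`).

It remains to see that the random formula is expanding up to `r = n ^ (11 / 20)`. If `s` clauses
have a small boundary, then all their variables lie in a set of `v ≈ (k / 2 + 1 / 40) s` variables.
The variables of one random clause lie in a given set of `v` variables with probability
`O((v / n) ^ k * c ^ (k - 1))`, whichever kind of clause it is (`randomClause_confined_le`).
The union bound over the sets of clauses and of variables gives
`(O(1) * (s / n) ^ (k / 2 - 41 / 40) * c ^ (k - 1)) ^ s`, which sums to `o(1)` when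
`c = O(n ^ (1 / 10))` (`exists_union_bound`). As `r ^ 2 / n = n ^ (1 / 10)`, the exponent
`1 / 20` in the runtime is attained with room to spare, for all `k ≥ 3` alike.
-/

namespace CommunitySAT

section

variable {V : Type}

/-! ### Semantic resolution and restrictions -/

/-- The assignment `σ` satisfies the clause `C`. -/
def Holds (σ : V → Bool) (C : Clause V) : Prop := ∃ l ∈ C, σ l.1 = l.2

/-- Every assignment satisfying all clauses of `S` satisfies `C`. -/
def Entails (S : Set (Clause V)) (C : Clause V) : Prop :=
  ∀ σ : V → Bool, (∀ D ∈ S, Holds σ D) → Holds σ C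

/-- A semantic resolution derivation from `F`, listed with the latest clause first: every clause is
entailed by at most two clauses that are input clauses or occur earlier. Input clauses are free,
they need not be listed. -/
inductive Derivation (F : Set (Clause V)) : List (Clause V) → Prop
  | nil : Derivation F []
  | cons {L : List (Clause V)} {C : Clause V} (hL : Derivation F L) (S : List (Clause V))
      (hS : S.length ≤ 2) (hSL : ∀ D ∈ S, D ∈ F ∨ D ∈ L) (h : Entails {D | D ∈ S} C) :
      Derivation F (C :: L)

/-- The clauses that have a semantic resolution derivation from `F` in which all clauses but the
input clauses have at most `w` literals. -/
inductive WidthClosure (F : Set (Clause V)) (w : ℕ) : Clause V → Prop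
  | input {C : Clause V} (hC : C ∈ F) : WidthClosure F w C
  | infer {C : Clause V} (S : List (Clause V)) (hS : S.length ≤ 2)
      (hSF : ∀ D ∈ S, WidthClosure F w D) (h : Entails {D | D ∈ S} C) (hC : C.card ≤ w) :
      WidthClosure F w C

lemma Entails.of_subset {C D : Clause V} (h : C ⊆ D) : Entails {E | E ∈ [C]} D := by
  intro σ hσ
  obtain ⟨l, hl, e⟩ := hσ C (by simp)
  exact ⟨l, h hl, e⟩

lemma Entails.resolventOn [DecidableEq V] (C D : Clause V) (l : Lit V) :
    Entails {E | E ∈ [C, D]} (resolventOn C D l) := by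
  intro σ hσ
  obtain ⟨a, ha, ea⟩ := hσ C (by simp)
  obtain ⟨b, hb, eb⟩ := hσ D (by simp)
  by_cases h1 : a = l
  · refine ⟨b, ?_, eb⟩
    have : b ≠ l.neg := by
      rintro rfl
      subst h1
      simp [Lit.neg, ea] at eb
    simp [CommunitySAT.resolventOn, this, hb]
  · exact ⟨a, by simp [CommunitySAT.resolventOn, h1, ha], ea⟩

lemma WidthClosure.mono {F : Set (Clause V)} {w w' : ℕ} (hw : w ≤ w') {C : Clause V}
    (h : WidthClosure F w C) : WidthClosure F w' C := by
  induction h with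
  | input hC => exact .input hC
  | infer S hS _ h hC ih => exact .infer S hS ih h (hC.trans hw)

/-- A derivation without wide clauses stays inside the closure of the same width. -/
lemma Derivation.widthClosure {F : Set (Clause V)} {w : ℕ} {L : List (Clause V)}
    (hL : Derivation F L) (hw : ∀ C ∈ L, C.card ≤ w) : ∀ C ∈ L, WidthClosure F w C := by
  induction hL with
  | nil => simp
  | cons hL S hS hSL h ih =>
    have ih' := ih fun C hC => hw C (List.mem_cons_of_mem _ hC)
    intro C hC
    rcases List.mem_cons.1 hC with rfl | hC
    · exact .infer S hS (fun D hD => (hSL D hD).elim .input (ih' D)) h (hw _ (by simp))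
    · exact ih' C hC

lemma Lit.eq_or_eq_neg {l l' : Lit V} (h : l'.1 = l.1) : l' = l ∨ l' = l.neg := by
  obtain ⟨x, a⟩ := l
  obtain ⟨y, b⟩ := l'
  simp only at h
  subst h
  cases a <;> cases b <;> simp [Lit.neg]

@[simp] lemma Lit.neg_neg (l : Lit V) : l.neg.neg = l := by simp [Lit.neg]

variable [DecidableEq V]

/-- The clauses of `F` after making the literal `l` true: clauses containing `l` disappear, and the
complement of `l` is removed from the others. -/
def restrict (F : Set (Clause V)) (l : Lit V) : Set (Clause V) :=
  {E | ∃ C ∈ F, l ∉ C ∧ C.erase l.neg = E}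

/-- The restriction of a derivation, as for `restrict`. -/
def restrictList (L : List (Clause V)) (l : Lit V) : List (Clause V) :=
  (L.filter (fun C => l ∉ C)).map (fun C => C.erase l.neg)

lemma mem_restrictList {L : List (Clause V)} {l : Lit V} {E : Clause V} :
    E ∈ restrictList L l ↔ ∃ C ∈ L, l ∉ C ∧ C.erase l.neg = E := by
  simp [restrictList, and_assoc]

lemma var_ne_of_mem_restrict {C : Clause V} {l l' : Lit V} (hl : l ∉ C)
    (h : l' ∈ C.erase l.neg) : l'.1 ≠ l.1 := by
  intro e
  rw [Finset.mem_erase] at h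
  rcases Lit.eq_or_eq_neg e with rfl | rfl
  · exact hl h.2
  · exact h.1 rfl

lemma Entails.restrict {S : List (Clause V)} {C : Clause V} {l : Lit V}
    (h : Entails {D | D ∈ S} C) (hl : l ∉ C) :
    Entails {D | D ∈ restrictList S l} (C.erase l.neg) := by
  intro σ hσ
  obtain ⟨a, ha, ea⟩ := h (Function.update σ l.1 l.2) (by
    intro D hD
    by_cases hlD : l ∈ D
    · exact ⟨l, hlD, by simp⟩
    · obtain ⟨a, ha, ea⟩ := hσ (D.erase l.neg) (mem_restrictList.2 ⟨D, hD, hlD, rfl⟩)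
      refine ⟨a, Finset.mem_of_mem_erase ha, ?_⟩
      rwa [Function.update_of_ne (var_ne_of_mem_restrict hlD ha)])
  have ha' : a ∈ C.erase l.neg := by
    refine Finset.mem_erase.2 ⟨?_, ha⟩
    rintro rfl
    simp [Lit.neg] at ea
  refine ⟨a, ha', ?_⟩
  rwa [Function.update_of_ne (var_ne_of_mem_restrict hl ha')] at ea

lemma restrictList_length_le (L : List (Clause V)) (l : Lit V) :
    (restrictList L l).length ≤ L.length := by
  simpa [restrictList] using List.length_filter_le _ L

lemma Derivation.restrict {F : Set (Clause V)} {L : List (Clause V)} (hL : Derivation F L)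
    (l : Lit V) : Derivation (restrict F l) (restrictList L l) := by
  induction hL with
  | nil => exact .nil
  | @cons L C hL S hS hSL h ih =>
    by_cases hl : l ∈ C
    · simpa [restrictList, hl] using ih
    · have : restrictList (C :: L) l = C.erase l.neg :: restrictList L l := by
        simp [restrictList, hl]
      rw [this]
      refine .cons ih (restrictList S l) ((restrictList_length_le S l).trans hS) ?_ (h.restrict hl)
      intro D hD
      obtain ⟨E, hE, hlE, rfl⟩ := mem_restrictList.1 hD
      rcases hSL E hE with h | h
      · exact .inl ⟨E, h, hlE, rfl⟩
      · exact .inr (mem_restrictList.2 ⟨E, h, hlE, rfl⟩)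

/-- A narrow derivation from the restricted clauses lifts to the original ones, at the cost of
adding the complement of the restricting literal to every clause. -/
lemma WidthClosure.insert_of_restrict {F : Set (Clause V)} {w : ℕ} {l : Lit V} {E : Clause V}
    (hF : ∀ C ∈ F, C.card ≤ w) (h : WidthClosure (restrict F l) w E) :
    WidthClosure F (w + 1) (insert l.neg E) := by
  induction h with
  | @input C hC =>
    obtain ⟨C, hC, hl, rfl⟩ := hC
    refine .infer [C] (by simp) (by simpa using .input hC) (Entails.of_subset ?_) ?_
    · intro a ha
      by_cases h : a = l.neg <;> simp [h, ha]
    · exact (Finset.card_insert_le _ _).trans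
        (by have := Finset.card_erase_le (s := C) (a := l.neg); have := hF C hC; omega)
  | @infer C S hS _ h hC ih =>
    refine .infer (S.map (insert l.neg)) (by simpa using hS) ?_ ?_
      ((Finset.card_insert_le _ _).trans (by omega))
    · intro D hD
      obtain ⟨E, hE, rfl⟩ := List.mem_map.1 hD
      exact ih E hE
    · intro σ hσ
      by_cases hn : σ l.neg.1 = l.neg.2
      · exact ⟨_, Finset.mem_insert_self _ _, hn⟩
      · obtain ⟨a, ha, ea⟩ := h σ (by
          intro D hD
          obtain ⟨a, ha, ea⟩ := hσ (insert l.neg D) (List.mem_map.2 ⟨D, hD, rfl⟩)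
          rcases Finset.mem_insert.1 ha with rfl | ha
          · exact absurd ea hn
          · exact ⟨a, ha, ea⟩)
        exact ⟨a, Finset.mem_insert_of_mem ha, ea⟩

/-- Once the unit clause `l` is available, restricting by `l` costs no width. -/
lemma WidthClosure.of_restrict {F : Set (Clause V)} {w : ℕ} {l : Lit V} {E : Clause V}
    (hF : ∀ C ∈ F, C.card ≤ w) (hl : WidthClosure F w {l})
    (h : WidthClosure (CommunitySAT.restrict F l) w E) : WidthClosure F w E := by
  induction h with
  | @input C hC =>
    obtain ⟨C, hC, hlC, rfl⟩ := hC
    refine .infer [C, {l}] (by simp) ?_ ?_ ((Finset.card_erase_le).trans (hF C hC))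
    · simp only [List.mem_cons, List.not_mem_nil, or_false, forall_eq_or_imp, forall_eq]
      exact ⟨.input hC, hl⟩
    · intro σ hσ
      obtain ⟨a, ha, ea⟩ := hσ C (by simp)
      obtain ⟨b, hb, eb⟩ := hσ {l} (by simp)
      rw [Finset.mem_singleton] at hb
      subst hb
      refine ⟨a, Finset.mem_erase.2 ⟨?_, ha⟩, ea⟩
      rintro rfl
      simp [Lit.neg, eb] at ea
  | infer S hS _ h hC ih => exact .infer S hS ih h hC

/-! ### Size and width -/

lemma countP_mul_le_sum_countP_mem {α : Type} [DecidableEq α] (P : Finset α → Prop) [DecidablePred P]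
    (U : Finset α) (L : List (Finset α)) (hU : ∀ C ∈ L, C ⊆ U) (d : ℕ)
    (hd : ∀ C, P C → d ≤ C.card) :
    L.countP (fun C => P C) * d ≤ ∑ a ∈ U, L.countP (fun C => P C ∧ a ∈ C) := by
  induction L with
  | nil => simp
  | cons C L ih =>
    have ih' := ih fun D hD => hU D (List.mem_cons_of_mem _ hD)
    have hC := hU C (by simp)
    by_cases hP : P C
    · simp only [List.countP_cons, hP, decide_true, if_true, true_and, Finset.sum_add_distrib]
      have : ∑ a ∈ U, (if decide (a ∈ C) = true then 1 else 0) = C.card := by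
        simp [Finset.inter_eq_right.2 hC]
      rw [this, add_mul, one_mul]
      exact add_le_add ih' (hd C hP)
    · simpa [List.countP_cons, hP] using ih'

/-- Some literal occurs in many of the wide clauses of `L`. -/
lemma exists_frequent_literal {L : List (Clause V)} {X : Finset V} {d n : ℕ}
    (hL : ∀ C ∈ L, ∀ l ∈ C, l.1 ∈ X) (hX : X.card ≤ n) (hX0 : X.Nonempty) :
    ∃ l : Lit V, l.1 ∈ X ∧ L.countP (fun C => d < C.card) * d ≤
      2 * n * L.countP (fun C => d < C.card ∧ l ∈ C) := by
  have key : L.countP (fun C => d < C.card) * d ≤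
      ∑ a ∈ X ×ˢ (Finset.univ : Finset Bool), L.countP (fun C => d < C.card ∧ a ∈ C) :=
    countP_mul_le_sum_countP_mem (fun C : Clause V => d < C.card) (X ×ˢ Finset.univ) L
    (fun C hC l hl => by simpa using hL C hC l hl) d (fun C hC => hC.le)
  by_contra! hcon
  have : ∑ a ∈ X ×ˢ (Finset.univ : Finset Bool), 2 * n * L.countP (fun C => d < C.card ∧ a ∈ C) <
      ∑ a ∈ X ×ˢ (Finset.univ : Finset Bool), L.countP (fun C => d < C.card) * d := by
    apply Finset.sum_lt_sum_of_nonempty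
    · exact hX0.product Finset.univ_nonempty
    · intro l hl
      exact hcon l (by simpa using hl)
  rw [← Finset.mul_sum, Finset.sum_const, Finset.card_product, smul_eq_mul] at this
  simp only [Finset.card_univ, Fintype.card_bool] at this
  have h2 : X.card * 2 * (L.countP (fun C => d < C.card) * d) ≤
      2 * n * (L.countP (fun C => d < C.card) * d) := Nat.mul_le_mul_right _ (by omega)
  have h3 := Nat.mul_le_mul_left (2 * n) key
  omega

lemma countP_restrictList_add_le (L : List (Clause V)) (l : Lit V) (d : ℕ) :
    (restrictList L l).countP (fun C => d < C.card) + L.countP (fun C => d < C.card ∧ l ∈ C) ≤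
      L.countP (fun C => d < C.card) := by
  induction L with
  | nil => simp [restrictList]
  | cons C L ih =>
    have hle := Finset.card_erase_le (s := C) (a := l.neg)
    by_cases hl : l ∈ C
    · have : restrictList (C :: L) l = restrictList L l := by simp [restrictList, hl]
      rw [this]
      simp only [List.countP_cons, hl, and_true]
      omega
    · have : restrictList (C :: L) l = C.erase l.neg :: restrictList L l := by
        simp [restrictList, hl]
      rw [this]
      simp only [List.countP_cons, hl, and_false, decide_eq_true_eq, if_false]
      split_ifs <;> omega

/-- The size-width relation of Ben-Sasson and Wigderson: a derivation of the empty clause with few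
clauses of more than `d` literals can be turned into one of width `d + b`. The literal `l` that
occurs most often in the wide clauses is branched on. Making it true kills a `d / 2n` fraction of
the wide clauses, which pays for the one unit of width lost in deriving the unit clause `¬l`;
making it false costs no width, but leaves fewer variables. -/
theorem widthClosure_of_derivation {d n : ℕ} :
    ∀ (N b : ℕ) (X : Finset V) (F : Set (Clause V)) (L : List (Clause V)),
      X.card = N → N ≤ n → (∀ C ∈ F, C.card ≤ d) → (∀ C ∈ F, ∀ l ∈ C, l.1 ∈ X) →
      (∀ C ∈ L, ∀ l ∈ C, l.1 ∈ X) → Derivation F L → (∅ ∈ F ∨ ∅ ∈ L) →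
      (L.countP (fun C => d < C.card) : ℝ) < Real.exp (b * (d / (2 * n))) →
      WidthClosure F (d + b) ∅ := by
  intro N
  induction N with
  | zero =>
    intro b X F L hX _ _ _ hLX hL h0 _
    have hd : ∀ C ∈ L, C.card ≤ d := by
      intro C hC
      have : C = ∅ := by
        refine Finset.eq_empty_of_forall_notMem fun l hl => ?_
        simpa [Finset.card_eq_zero.1 hX] using hLX C hC l hl
      simp [this]
    exact h0.elim .input fun h => (hL.widthClosure hd ∅ h).mono (by omega)
  | succ N ih =>
    intro b X F L hX hn hFd hFX hLX hL h0 hfat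
    by_cases hd : ∀ C ∈ L, C.card ≤ d
    · exact h0.elim .input fun h => (hL.widthClosure hd ∅ h).mono (by omega)
    have hpos : 0 < L.countP (fun C => d < C.card) := by
      rw [List.countP_pos_iff]
      push Not at hd
      simpa using hd
    obtain ⟨l, hlX, hl⟩ := exists_frequent_literal (d := d) hLX (hX.le.trans hn)
      (Finset.card_pos.1 (by omega))
    have hn0 : (0 : ℝ) < n := by exact_mod_cast (show 0 < n by omega)
    have hres : ∀ l' : Lit V, l'.1 = l.1 → ∀ b' : ℕ,
        ((restrictList L l').countP (fun C => d < C.card) : ℝ) <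
          Real.exp (b' * (d / (2 * n))) → WidthClosure (restrict F l') (d + b') ∅ := by
      intro l' hl' b' hfat'
      refine ih b' (X.erase l.1) (restrict F l') (restrictList L l') ?_ (by omega) ?_ ?_ ?_
        (hL.restrict l') ?_ hfat'
      · rw [Finset.card_erase_of_mem hlX, hX]; rfl
      · rintro _ ⟨C, hC, -, rfl⟩
        exact Finset.card_erase_le.trans (hFd C hC)
      · rintro _ ⟨C, hC, hlC, rfl⟩ a ha
        exact Finset.mem_erase.2 ⟨hl' ▸ var_ne_of_mem_restrict hlC ha,
          hFX C hC a (Finset.mem_of_mem_erase ha)⟩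
      · intro E hE a ha
        obtain ⟨C, hC, hlC, rfl⟩ := mem_restrictList.1 hE
        exact Finset.mem_erase.2 ⟨hl' ▸ var_ne_of_mem_restrict hlC ha,
          hLX C hC a (Finset.mem_of_mem_erase ha)⟩
      · refine h0.imp (fun h => ⟨∅, h, by simp, by simp⟩) fun h => ?_
        exact mem_restrictList.2 ⟨∅, h, by simp, by simp⟩
    obtain _ | b := b
    · rw [Nat.cast_zero, zero_mul, Real.exp_zero] at hfat
      have : L.countP (fun C => d < C.card) < 1 := by exact_mod_cast hfat
      omega
    have h1 : WidthClosure (restrict F l) (d + b) ∅ := by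
      refine hres l rfl b ?_
      set x : ℝ := d / (2 * n) with hx
      set f : ℕ := L.countP (fun C => d < C.card)
      have hcount := countP_restrictList_add_le L l d
      have hcount' : ((restrictList L l).countP (fun C => d < C.card) : ℝ) +
          L.countP (fun C => d < C.card ∧ l ∈ C) ≤ f := by exact_mod_cast hcount
      have hl' : (f : ℝ) * d ≤ 2 * n * L.countP (fun C => d < C.card ∧ l ∈ C) := by
        exact_mod_cast hl
      have h3 : (f : ℝ) * x ≤ L.countP (fun C => d < C.card ∧ l ∈ C) := by
        rw [hx, ← mul_div_assoc, div_le_iff₀ (by positivity)]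
        linarith
      calc ((restrictList L l).countP (fun C => d < C.card) : ℝ) ≤ f * (1 - x) := by linarith
        _ ≤ f * Real.exp (-x) := by
          gcongr
          linarith [Real.add_one_le_exp (-x)]
        _ < Real.exp ((b + 1 : ℕ) * x) * Real.exp (-x) := by
          gcongr
        _ = Real.exp (b * x) := by
          rw [← Real.exp_add]; congr 1; push_cast; ring
    have h2 : WidthClosure (restrict F l.neg) (d + (b + 1)) ∅ := by
      refine hres l.neg rfl (b + 1) (lt_of_le_of_lt ?_ hfat)
      have := countP_restrictList_add_le L l.neg d
      exact_mod_cast (Nat.le_add_right _ _).trans this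
    refine WidthClosure.of_restrict (l := l.neg) (fun C hC => (hFd C hC).trans (by omega)) ?_ h2
    exact h1.insert_of_restrict fun C hC => (hFd C hC).trans (by omega)

end

section

variable {V : Type} [DecidableEq V]

/-! ### From runs of a solver to derivations -/

/-- Every propagated literal of the trail was forced by its reason, which is an input clause or
occurs in `L`. -/
def TrailForced (F : Set (Clause V)) (L : List (Clause V)) : List (TrailEntry V) → Prop
  | [] => True
  | e :: T => (∀ R, e.reason = some R → (R ∈ F ∨ R ∈ L) ∧ e.lit ∈ R ∧ Falsified T (R.erase e.lit)) ∧
      TrailForced F L T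

lemma TrailForced.mono {F : Set (Clause V)} {L L' : List (Clause V)} (h : ∀ C ∈ L, C ∈ L')
    {T : List (TrailEntry V)} (hT : TrailForced F L T) : TrailForced F L' T := by
  induction T with
  | nil => trivial
  | cons e T ih =>
    refine ⟨fun R hR => ?_, ih hT.2⟩
    obtain ⟨h1, h2⟩ := hT.1 R hR
    exact ⟨h1.imp_right (h R), h2⟩

lemma TrailForced.suffix {F : Set (Clause V)} {L : List (Clause V)} {T T' : List (TrailEntry V)}
    (hT : TrailForced F L T) (h : T' <:+ T) : TrailForced F L T' := by
  induction T with
  | nil => rw [List.suffix_nil.1 h]; trivial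
  | cons e T ih =>
    rcases List.suffix_cons_iff.1 h with rfl | h
    · exact hT
    · exact ih hT.2 h

lemma TrailForced.reason {F : Set (Clause V)} {L : List (Clause V)} {T : List (TrailEntry V)}
    (hT : TrailForced F L T) {l : Lit V} {R : Clause V} (h : (⟨l, some R⟩ : TrailEntry V) ∈ T) :
    R ∈ F ∨ R ∈ L := by
  induction T with
  | nil => simp at h
  | cons e T ih =>
    rcases List.mem_cons.1 h with rfl | h
    · exact (hT.1 R rfl).1
    · exact ih hT.2 h

/-- All clauses occurring in the state `s` are input clauses or belong to a derivation with at most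
`t` lines, and the trail has at most `t` entries. This holds for a state reached in `t` steps. -/
def Accounted (F : Set (Clause V)) (t : ℕ) (s : State V) : Prop :=
  ∃ L, Derivation F L ∧ L.length ≤ t ∧ s.trail.length ≤ t ∧ (∀ C ∈ s.db, C ∈ F ∨ C ∈ L) ∧
    (∀ C, s.conflict = some C → C ∈ F ∨ C ∈ L) ∧ TrailForced F L s.trail

lemma Accounted.mono {F : Set (Clause V)} {t t' : ℕ} (ht : t ≤ t') {s : State V}
    (h : Accounted F t s) : Accounted F t' s := by
  obtain ⟨L, h1, h2, h3, h4⟩ := h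
  exact ⟨L, h1, h2.trans ht, h3.trans ht, h4⟩

lemma Derivation.cons_resolventOn {F : Set (Clause V)} {L : List (Clause V)}
    (hL : Derivation F L) {C D : Clause V} (hC : C ∈ F ∨ C ∈ L) (hD : D ∈ F ∨ D ∈ L) (l : Lit V) :
    Derivation F (resolventOn C D l :: L) :=
  .cons hL [C, D] (by simp) (by simpa using ⟨hC, hD⟩) (Entails.resolventOn C D l)

lemma Accounted.step {F : Set (Clause V)} {t : ℕ} {s s' : State V} (h : Accounted F t s)
    (hs : Step s s') : Accounted F (t + 1) s' := by
  obtain ⟨L, hL, hLt, hTt, hdb, hconf, hT⟩ := h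
  cases hs with
  | decide T F' l hl =>
    exact ⟨L, hL, by omega, by simpa using hTt, hdb, by simp, by simp, hT⟩
  | propagate T F' C l hC hlC hl hfal =>
    refine ⟨L, hL, by omega, by simpa using hTt, hdb, by simp, ?_, hT⟩
    rintro R ⟨⟩
    exact ⟨hdb C hC, hlC, hfal⟩
  | conflict T F' C hC hfal =>
    refine ⟨L, hL, by omega, by simp only at hTt ⊢; omega, hdb, ?_, hT⟩
    rintro D ⟨⟩
    exact hdb C hC
  | explain T F' C R l hl hlC =>
    refine ⟨resolventOn R C l :: L, hL.cons_resolventOn (hT.reason hl) (hconf C rfl) l, by simpa,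
      by simp only at hTt ⊢; omega, fun D hD => (hdb D hD).imp_right (List.mem_cons_of_mem _), ?_,
      hT.mono fun D => List.mem_cons_of_mem _⟩
    rintro D ⟨⟩
    exact .inr (by simp)
  | learn T T' F' C hT' =>
    refine ⟨L, hL, by omega, hT'.length_le.trans (by simp only at hTt; omega), ?_, by simp,
      hT.suffix hT'⟩
    rintro D (rfl | hD)
    · exact hconf D rfl
    · exact hdb D hD
  | restart T T' F' hT' =>
    exact ⟨L, hL, by omega, hT'.length_le.trans (by simp only at hTt; omega), hdb, by simp,
      hT.suffix hT'⟩
  | forget T F' F'' hF =>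
    exact ⟨L, hL, by omega, by simp only at hTt ⊢; omega, fun C hC => hdb C (hF hC), by simp, hT⟩
  | inprocess T F' C D l hC hD hlC hlD =>
    refine ⟨resolventOn C D l :: L, hL.cons_resolventOn (hdb C hC) (hdb D hD) l, by simpa,
      by simp only at hTt ⊢; omega, ?_, by simp, hT.mono fun D => List.mem_cons_of_mem _⟩
    rintro E (rfl | hE)
    · exact .inr (by simp)
    · exact (hdb E hE).imp_right (List.mem_cons_of_mem _)

lemma Solver.history_ne_nil (S : Solver V) (F : Set (Clause V)) (t : ℕ) :
    S.history F t ≠ [] := by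
  induction t with
  | zero => simp [Solver.history]
  | succ t ih =>
    rw [Solver.history]
    split
    · simp
    · exact ih

lemma Solver.accounted_of_mem_history (S : Solver V) (F : Set (Clause V)) (t : ℕ) :
    ∀ s ∈ S.history F t, Accounted F t s := by
  induction t with
  | zero =>
    intro s hs
    have hs' : s = State.init F := by simpa [Solver.history] using hs
    subst hs'
    exact ⟨[], .nil, by simp, by simp [State.init], fun C hC => .inl hC, by simp [State.init],
      trivial⟩
  | succ t ih =>
    intro s hs
    rw [Solver.history] at hs
    cases hn : S.next (S.history F t) with
    | none =>
      simp only [hn] at hs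
      exact (ih s hs).mono (Nat.le_succ t)
    | some s' =>
      simp only [hn] at hs
      rcases List.mem_cons.1 hs with rfl | hs
      · obtain ⟨s₀, h, e⟩ := List.exists_cons_of_ne_nil (S.history_ne_nil F t)
        rw [e] at hn
        exact (ih s₀ (by simp [e])).step (S.legal s₀ h s hn)
      · exact (ih s hs).mono (Nat.le_succ t)

/-- A clause falsified by a trail without decisions is reduced to the empty clause by resolving it
with the reasons, in reverse order of propagation. -/
lemma exists_derivation_empty_of_falsified {F : Set (Clause V)} (T : List (TrailEntry V)) :
    ∀ (L : List (Clause V)) (C : Clause V), Derivation F L → TrailForced F L T →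
      (∀ e ∈ T, e.reason ≠ none) → (C ∈ F ∨ C ∈ L) → Falsified T C →
      ∃ L', Derivation F L' ∧ L'.length ≤ L.length + T.length ∧ (∅ ∈ F ∨ ∅ ∈ L') := by
  induction T with
  | nil =>
    intro L C hL _ _ hC hfal
    have : C = ∅ := Finset.eq_empty_of_forall_notMem fun l hl => by
      simpa [AssignedTrue] using hfal l hl
    subst this
    exact ⟨L, hL, by simp, hC⟩
  | cons e T ih =>
    intro L C hL hT hdec hC hfal
    have hdec' : ∀ e ∈ T, e.reason ≠ none := fun a ha => hdec a (List.mem_cons_of_mem _ ha)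
    have hrest : ∀ a ∈ C, a ≠ e.lit.neg → AssignedTrue T a.neg := by
      intro a ha hne
      obtain ⟨b, hb, eb⟩ := hfal a ha
      rcases List.mem_cons.1 hb with rfl | hb
      · exact absurd (by rw [eb, Lit.neg_neg]) hne
      · exact ⟨b, hb, eb⟩
    by_cases hneg : e.lit.neg ∈ C
    · obtain ⟨R, hR⟩ := Option.ne_none_iff_exists'.1 (hdec e (by simp))
      obtain ⟨hRL, -, hRT⟩ := hT.1 R hR
      obtain ⟨L', h1, h2, h3⟩ := ih (resolventOn R C e.lit :: L) (resolventOn R C e.lit)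
        (hL.cons_resolventOn hRL hC e.lit) (hT.2.mono fun D => List.mem_cons_of_mem _) hdec'
        (.inr (by simp)) (by
          intro a ha
          rcases Finset.mem_union.1 ha with ha | ha
          · exact hRT a ha
          · exact hrest a (Finset.mem_of_mem_erase ha) (Finset.ne_of_mem_erase ha))
      exact ⟨L', h1, by simp only [List.length_cons] at h2 ⊢; omega, h3⟩
    · obtain ⟨L', h1, h2, h3⟩ := ih L C hL hT.2 hdec' hC
        fun a ha => hrest a ha fun h => hneg (h ▸ ha)
      exact ⟨L', h1, by simp only [List.length_cons] at h2 ⊢; omega, h3⟩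

/-- A run of `t` steps that establishes unsatisfiability yields a derivation of the empty clause
with at most `2 * t` lines: at most one line per step, and at most one for each entry of the final
trail. -/
theorem Solver.exists_derivation (S : Solver V) (F : Set (Clause V)) (t : ℕ)
    (h : ∃ s ∈ S.history F t, s.Refuted) :
    ∃ L, Derivation F L ∧ L.length ≤ 2 * t ∧ (∅ ∈ F ∨ ∅ ∈ L) := by
  obtain ⟨s, hs, T, hTs, hdec, C, hC, hfal⟩ := h
  obtain ⟨L, hL, hLt, hTt, hdb, -, hT⟩ := S.accounted_of_mem_history F t s hs
  obtain ⟨L', h1, h2, h3⟩ := exists_derivation_empty_of_falsified T L C hL (hT.suffix hTs) hdec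
    (hdb C hC) hfal
  exact ⟨L', h1, by have := hTs.length_le; omega, h3⟩

end

section

variable {V ι : Type} [DecidableEq V]

/-! ### Expansion and width -/

/-- The set of variables of a clause. -/
def vars (C : Clause V) : Finset V := C.image Prod.fst

/-- The variables of the clauses with indices in `I`. -/
def varsOf (φ : ι → Clause V) (I : Finset ι) : Finset V := I.biUnion fun i => vars (φ i)

/-- The boundary of a set of clause indices: the variables that occur in exactly one of these
clauses. -/
def boundary (φ : ι → Clause V) (I : Finset ι) : Finset V :=
  (varsOf φ I).filter fun x => (I.filter fun i => x ∈ vars (φ i)).card = 1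

lemma card_vars_le (C : Clause V) : (vars C).card ≤ C.card := Finset.card_image_le

lemma two_mul_card_varsOf_le {φ : ι → Clause V} {k : ℕ} (hk : ∀ i, (φ i).card ≤ k)
    (I : Finset ι) : 2 * (varsOf φ I).card ≤ (boundary φ I).card + k * I.card := by
  have h1 : ∑ x ∈ varsOf φ I, (I.filter fun i => x ∈ vars (φ i)).card ≤ k * I.card := by
    simp only [Finset.card_filter]
    rw [Finset.sum_comm, mul_comm, ← smul_eq_mul]
    refine Finset.sum_le_card_nsmul _ _ _ fun i hi => ?_
    rw [← Finset.card_filter]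
    refine (Finset.card_le_card ?_).trans ((card_vars_le (φ i)).trans (hk i))
    intro x hx
    exact (Finset.mem_filter.1 hx).2
  have h2 : ∑ x ∈ varsOf φ I, 2 ≤ ∑ x ∈ varsOf φ I,
      ((if (I.filter fun i => x ∈ vars (φ i)).card = 1 then 1 else 0) +
        (I.filter fun i => x ∈ vars (φ i)).card) := by
    refine Finset.sum_le_sum fun x hx => ?_
    obtain ⟨i, hi, hxi⟩ := Finset.mem_biUnion.1 hx
    have : 0 < (I.filter fun i => x ∈ vars (φ i)).card :=
      Finset.card_pos.2 ⟨i, Finset.mem_filter.2 ⟨hi, hxi⟩⟩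
    split_ifs <;> omega
  rw [Finset.sum_add_distrib, ← Finset.card_filter, Finset.sum_const, smul_eq_mul] at h2
  rw [boundary]
  omega

/-- If the clauses with indices in `I` entail `C`, but no proper subset of them does, then every
boundary variable of `I` occurs in `C`: otherwise an assignment that falsifies `C` and satisfies all
clauses but one could be corrected on a boundary variable of the last clause. -/
lemma boundary_subset_vars {φ : ι → Clause V} {I : Finset ι} {C : Clause V}
    (hI : Entails (φ '' I) C) (hmin : ∀ J ⊂ I, ¬ Entails (φ '' J) C) :
    boundary φ I ⊆ vars C := by
  classical
  intro x hx
  by_contra hxC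
  obtain ⟨i, hi⟩ := Finset.card_eq_one.1 (Finset.mem_filter.1 hx).2
  have hiI : i ∈ I ∧ x ∈ vars (φ i) := by
    have : i ∈ I.filter fun i => x ∈ vars (φ i) := by simp [hi]
    simpa using this
  have huniq : ∀ j ∈ I, x ∈ vars (φ j) → j = i := by
    intro j hj hxj
    have : j ∈ I.filter fun i => x ∈ vars (φ i) := by simp [hj, hxj]
    simpa [hi] using this
  have hno := hmin (I.erase i) (Finset.erase_ssubset hiI.1)
  simp only [Entails, not_forall] at hno
  obtain ⟨σ, hσ, hC⟩ := hno
  obtain ⟨l, hl, rfl⟩ := Finset.mem_image.1 hiI.2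
  obtain ⟨a, ha, ea⟩ := hI (Function.update σ l.1 l.2) (by
    rintro _ ⟨j, hj, rfl⟩
    by_cases hji : j = i
    · subst hji
      exact ⟨l, hl, by simp⟩
    · obtain ⟨a, ha, ea⟩ := hσ (φ j) ⟨j, by simpa [hji] using hj, rfl⟩
      refine ⟨a, ha, ?_⟩
      rw [Function.update_of_ne, ea]
      intro h
      exact hji (huniq j hj (h ▸ Finset.mem_image_of_mem _ ha)))
  refine hC ⟨a, ha, ?_⟩
  rwa [Function.update_of_ne] at ea
  intro h
  exact hxC (h ▸ Finset.mem_image_of_mem _ ha)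

lemma exists_minimal_entails {φ : ι → Clause V} {I : Finset ι} {C : Clause V}
    (hI : Entails (φ '' I) C) :
    ∃ J ⊆ I, Entails (φ '' J) C ∧ boundary φ J ⊆ vars C := by
  classical
  induction I using Finset.strongInduction with
  | H I ih =>
    by_cases h : ∃ J ⊂ I, Entails (φ '' J) C
    · obtain ⟨J, hJ, hJC⟩ := h
      obtain ⟨K, hK, h1⟩ := ih J hJ hJC
      exact ⟨K, hK.trans hJ.1, h1⟩
    · push Not at h
      exact ⟨I, subset_rfl, hI, boundary_subset_vars hI h⟩

/-- Every nonempty set of at most `r` clauses has a boundary of at least one twentieth of its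
size. -/
def BoundaryExpanding (φ : ι → Clause V) (r : ℕ) : Prop :=
  ∀ I : Finset ι, I.card ≤ r → I.card ≤ 20 * (boundary φ I).card

/-- A clause derivable in small width from an expanding formula is entailed by at most `r/2`
of its clauses: a derived clause is entailed by at most `r` clauses, and if it needed more than
`r/2` of them then it would contain their large boundary. -/
lemma WidthClosure.exists_entails {φ : ι → Clause V} {r w : ℕ} (hr : 2 ≤ r) (hw : 40 * w ≤ r)
    (hφ : BoundaryExpanding φ r) {C : Clause V} (hC : WidthClosure (Set.range φ) w C) :
    ∃ I : Finset ι, 2 * I.card ≤ r ∧ Entails (φ '' I) C := by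
  classical
  induction hC with
  | input hC =>
    obtain ⟨i, rfl⟩ := hC
    exact ⟨{i}, by simpa using hr, fun σ hσ => hσ _ (by simp)⟩
  | @infer C S hS _ h hCw ih =>
    have key : ∃ I : Finset ι, I.card ≤ r ∧ Entails (φ '' I) C := by
      choose! f hf using ih
      refine ⟨S.toFinset.biUnion f, ?_, fun σ hσ => h σ fun D hD => ?_⟩
      · have h1 : ∑ D ∈ S.toFinset, 2 * (f D).card ≤ S.toFinset.card • r :=
          Finset.sum_le_card_nsmul _ _ _ fun D hD => (hf D (by simpa using hD)).1
        have h2 := Finset.card_biUnion_le (s := S.toFinset) (t := f)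
        have h3 : S.toFinset.card • r ≤ 2 * r :=
          Nat.mul_le_mul_right r (S.toFinset_card_le.trans hS)
        rw [← Finset.mul_sum] at h1
        omega
      · refine (hf D hD).2 σ ?_
        rintro _ ⟨i, hi, rfl⟩
        exact hσ _ ⟨i, Finset.mem_biUnion.2 ⟨D, by simpa using hD, hi⟩, rfl⟩
    obtain ⟨I, hIr, hI⟩ := key
    obtain ⟨J, hJI, hJ, hJC⟩ := exists_minimal_entails hI
    refine ⟨J, ?_, hJ⟩
    have h1 := hφ J ((Finset.card_le_card hJI).trans hIr)
    have h2 := (Finset.card_le_card hJC).trans ((card_vars_le C).trans hCw)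
    omega

theorem BoundaryExpanding.not_widthClosure_empty {φ : ι → Clause V} {r w : ℕ} (hr : 2 ≤ r)
    (hw : 40 * w ≤ r) (hφ : BoundaryExpanding φ r) : ¬ WidthClosure (Set.range φ) w ∅ := by
  intro h
  obtain ⟨I, hIr, hI⟩ := h.exists_entails hr hw hφ
  obtain ⟨J, hJI, hJ, hJC⟩ := exists_minimal_entails hI
  have h1 := hφ J ((Finset.card_le_card hJI).trans (by omega))
  have h2 : boundary φ J = ∅ := by simpa [vars] using hJC
  have h3 : J = ∅ := by simpa [h2] using h1
  subst h3
  obtain ⟨l, hl, -⟩ := hJ (fun _ => true) (by simp)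
  simp at hl

/-- The runtime bound on expanding formulas: the width bound `2 * d`, turned into a size bound. -/
theorem BoundaryExpanding.le_runtime {n m k r d : ℕ} {φ : Fin m → Clause (Fin n)} (hr : 2 ≤ r)
    (hd : 80 * d ≤ r) (hkd : k ≤ d) (hφ : BoundaryExpanding φ r) (hk : ∀ i, (φ i).card ≤ k)
    {B : ℝ} (hB : 2 * B ≤ Real.exp (d * (d / (2 * n)))) : φ ∈ hardEvent n m B := by
  intro S
  by_contra! hlt
  have : ∃ t : ℕ, (∃ s ∈ S.history (Set.range φ) t, s.Refuted) ∧ (t : ℝ) < B := by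
    obtain ⟨N, hN⟩ := ENat.ne_top_iff_exists.1 (ENat.toENNReal_ne_top.1 (ne_top_of_lt hlt))
    have h1 : S.runtime (Set.range φ) < (N + 1 : ℕ) := by rw [← hN]; exact_mod_cast N.lt_succ_self
    obtain ⟨t, ht⟩ := iInf_lt_iff.1 h1
    obtain ⟨ht, htN⟩ := iInf_lt_iff.1 ht
    refine ⟨t, ht, ?_⟩
    rw [← hN, ENat.toENNReal_coe, ← ENNReal.ofReal_natCast] at hlt
    have h2 : t ≤ N := Nat.lt_succ_iff.1 (by exact_mod_cast htN)
    exact lt_of_le_of_lt (by exact_mod_cast h2) (ENNReal.ofReal_lt_ofReal_iff'.1 hlt).1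
  obtain ⟨t, ht, htB⟩ := this
  obtain ⟨L, hL, hLt, h0⟩ := S.exists_derivation (Set.range φ) t ht
  refine hφ.not_widthClosure_empty hr (w := d + d) (by omega) ?_
  refine widthClosure_of_derivation (n := n) n d Finset.univ (Set.range φ) L (by simp) le_rfl ?_
    (by simp) (by simp) hL h0 ?_
  · rintro _ ⟨i, rfl⟩
    exact (hk i).trans hkd
  · refine lt_of_lt_of_le ?_ hB
    have h1 : L.countP (fun C => d < C.card) ≤ 2 * t := List.countP_le_length.trans hLt
    have h2 : (L.countP (fun C => d < C.card) : ℝ) ≤ 2 * t := by exact_mod_cast h1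
    linarith

end

/-! ### Counting clauses -/

lemma card_clauses_on_le {n k : ℕ} (W : Finset (Fin n)) (A : Finset (Clause (Fin n)))
    (hA : ∀ C ∈ A, IsKClause k C ∧ vars C ⊆ W) : A.card ≤ (2 * W.card) ^ k := by
  have h : A ⊆ (W ×ˢ (Finset.univ : Finset Bool)).powersetCard k := by
    intro C hC
    refine Finset.mem_powersetCard.2 ⟨fun l hl => ?_, (hA C hC).1.1⟩
    simpa using (hA C hC).2 (Finset.mem_image_of_mem _ hl)
  refine (Finset.card_le_card h).trans ?_
  rw [Finset.card_powersetCard, Finset.card_product, Finset.card_univ, Fintype.card_bool, mul_comm]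
  exact Nat.choose_le_pow _ _

/-- The clause of the positive literals of the variables `g 0, …, g (k - 1)`. -/
def positiveClause {n k : ℕ} (g : Fin k → Fin n) : Clause (Fin n) :=
  Finset.univ.image fun j => (g j, true)

lemma mem_positiveClause {n k : ℕ} {g : Fin k → Fin n} {l : Lit (Fin n)} :
    l ∈ positiveClause g ↔ ∃ j, (g j, true) = l := by
  simp [positiveClause]

lemma isKClause_positiveClause {n k : ℕ} {g : Fin k → Fin n} (hg : Function.Injective g) :
    IsKClause k (positiveClause g) := by
  refine ⟨?_, ?_⟩
  · rw [positiveClause, Finset.card_image_of_injective _ fun a b h => hg (congrArg Prod.fst h)]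
    simp
  · intro l hl l' hl' e
    obtain ⟨j, rfl⟩ := mem_positiveClause.1 hl
    obtain ⟨j', rfl⟩ := mem_positiveClause.1 hl'
    exact Prod.ext e rfl

/-- If the variables indexed by `κ × Fin k × β` are distinct, then choosing an index in `κ`
and, for each `j`, a variable of the block `j` gives distinct clauses. -/
lemma card_mul_card_pow_le {n k : ℕ} {κ β T : Type} [Fintype κ] [Fintype β] [Finite T] (hk : 0 < k)
    (e : κ × Fin k × β → Fin n) (he : Function.Injective e) (P : T → Clause (Fin n))
    (h : ∀ i (g : Fin k → β), ∃ t, P t = positiveClause fun j => e (i, j, g j)) :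
    Fintype.card κ * Fintype.card β ^ k ≤ Nat.card T := by
  choose F hF using h
  have hinj : Function.Injective fun x : κ × (Fin k → β) => F x.1 x.2 := by
    rintro ⟨i, g⟩ ⟨i', g'⟩ heq
    have heq' : positiveClause (fun j => e (i, j, g j)) =
        positiveClause fun j => e (i', j, g' j) := by
      rw [← hF, ← hF]; exact congrArg P heq
    have key : ∀ j, i = i' ∧ g j = g' j := by
      intro j
      have hj : (e (i, j, g j), true) ∈ positiveClause fun j => e (i', j, g' j) := by
        rw [← heq']; exact mem_positiveClause.2 ⟨j, rfl⟩
      obtain ⟨j', hj'⟩ := mem_positiveClause.1 hj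
      have := he (congrArg Prod.fst hj')
      simp only [Prod.mk.injEq] at this
      obtain ⟨h1, rfl, h2⟩ := this
      exact ⟨h1.symm, h2.symm⟩
    exact Prod.ext (key ⟨0, hk⟩).1 (funext fun j => (key j).2)
  have := Nat.card_le_card_of_injective _ hinj
  simpa using this

lemma exists_enumeration {n c : ℕ} (f : Communities n c) :
    ∃ e : Fin c × Fin (n / c) → Fin n, Function.Injective e ∧ ∀ x, f.1 (e x) = x.1 := by
  let E (i : Fin c) : Fin (n / c) ≃ {v : Fin n // f.1 v = i} :=
    (Finite.equivFinOfCardEq (f.2 i)).symm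
  refine ⟨fun x => (E x.1 x.2).1, ?_, fun x => (E x.1 x.2).2⟩
  rintro ⟨i, a⟩ ⟨i', a'⟩ h
  obtain rfl : i = i' := by
    rw [← (E i a).2, ← (E i' a').2]
    exact congrArg f.1 h
  exact Prod.ext rfl ((E i).injective (Subtype.ext h))

lemma card_within_ge {n c k : ℕ} (hk : 0 < k) (f : Communities n c) :
    c * (n / c / k) ^ k ≤ Nat.card (WithinClause k f.1) := by
  obtain ⟨e, he, hf⟩ := exists_enumeration f
  have hle : k * (n / c / k) ≤ n / c := Nat.mul_div_le _ _
  let e' : Fin c × Fin k × Fin (n / c / k) → Fin n :=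
    fun x => e (x.1, Fin.castLE hle (finProdFinEquiv x.2))
  have he' : Function.Injective e' := by
    rintro ⟨i, y⟩ ⟨i', y'⟩ h
    have := he h
    simp only [Prod.mk.injEq] at this
    exact Prod.ext this.1 (finProdFinEquiv.injective (Fin.castLE_injective hle this.2))
  have := card_mul_card_pow_le (T := WithinClause k f.1) hk e' he' Subtype.val (by
    intro i g
    refine ⟨⟨_, isKClause_positiveClause ?_, i, ?_⟩, rfl⟩
    · intro j j' h
      have := he' h
      simp only [Prod.mk.injEq] at this
      exact this.2.1
    · intro l hl
      obtain ⟨j, rfl⟩ := mem_positiveClause.1 hl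
      exact hf _)
  simpa using this

lemma card_bridge_ge {n c k : ℕ} (hk : 0 < k) (f : Communities n c) :
    (c / k * (n / c)) ^ k ≤ Nat.card (BridgeClause k f.1) := by
  obtain ⟨e, he, hf⟩ := exists_enumeration f
  have hle : k * (c / k) ≤ c := Nat.mul_div_le _ _
  let e' : Unit × Fin k × (Fin (c / k) × Fin (n / c)) → Fin n :=
    fun x => e (Fin.castLE hle (finProdFinEquiv (x.2.1, x.2.2.1)), x.2.2.2)
  have he1 : ∀ x y, f.1 (e' x) = f.1 (e' y) → x.2.1 = y.2.1 ∧ x.2.2.1 = y.2.2.1 := by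
    intro x y h
    rw [hf, hf] at h
    simpa using finProdFinEquiv.injective (Fin.castLE_injective hle h)
  have he' : Function.Injective e' := by
    intro x y h
    have h1 := he1 x y (congrArg f.1 h)
    have h2 := congrArg Prod.snd (he h)
    exact Prod.ext rfl (Prod.ext h1.1 (Prod.ext h1.2 h2))
  have := card_mul_card_pow_le (T := BridgeClause k f.1) hk e' he' Subtype.val (by
    intro i g
    refine ⟨⟨_, isKClause_positiveClause ?_, ?_⟩, rfl⟩
    · intro j j' h
      exact (he1 _ _ (congrArg f.1 h)).1
    · intro l hl l' hl' h
      obtain ⟨j, rfl⟩ := mem_positiveClause.1 hl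
      obtain ⟨j', rfl⟩ := mem_positiveClause.1 hl'
      obtain rfl : j = j' := (he1 _ _ h).1
      rfl)
  simpa using this

/-! ### A single random clause -/

/-- An upper bound for the probability that all variables of a random clause lie in a given set of
`v` variables. -/
noncomputable def confinementBound (k n c v : ℕ) : ℝ := (4 * k * v / n) ^ k * (c : ℝ) ^ (k - 1)

lemma confinementBound_nonneg (k n c v : ℕ) : 0 ≤ confinementBound k n c v := by
  unfold confinementBound; positivity

lemma uniform_confined_le {n k : ℕ} {P : Clause (Fin n) → Prop}
    [Fintype {C : Clause (Fin n) // P C}] [Nonempty {C : Clause (Fin n) // P C}]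
    (hP : ∀ C, P C → IsKClause k C) (W : Finset (Fin n)) {x : ℝ} (hx : 0 ≤ x)
    (h : ((2 * W.card : ℕ) : ℝ) ^ k ≤ x * Nat.card {C : Clause (Fin n) // P C}) :
    ((PMF.uniformOfFintype {C : Clause (Fin n) // P C}).map Subtype.val).toOuterMeasure
      {C | vars C ⊆ W} ≤ ENNReal.ofReal x := by
  classical
  rw [PMF.toOuterMeasure_map_apply, PMF.toOuterMeasure_uniformOfFintype_apply]
  refine ENNReal.div_le_of_le_mul ?_
  have h1 : Fintype.card (Subtype.val ⁻¹' {C | vars C ⊆ W} : Set {C : Clause (Fin n) // P C}) ≤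
      (2 * W.card) ^ k := by
    refine le_trans ?_ (card_clauses_on_le (k := k) W
      (Finset.univ.filter fun C => IsKClause k C ∧ vars C ⊆ W) (by simp))
    rw [← Fintype.card_subtype]
    exact Fintype.card_le_of_injective (fun y => ⟨y.1.1, hP _ y.1.2, y.2⟩)
      fun a b hab => Subtype.ext (Subtype.ext (congrArg (fun z => z.1) hab))
  rw [← ENNReal.ofReal_natCast, ← ENNReal.ofReal_natCast, ← ENNReal.ofReal_mul hx]
  apply ENNReal.ofReal_le_ofReal
  rw [← Nat.card_eq_fintype_card (α := {C : Clause (Fin n) // P C})]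
  refine le_trans ?_ h
  exact_mod_cast h1

lemma le_two_mul_mul_div {a k : ℕ} (hk : 0 < k) (h : k ≤ a) : a ≤ 2 * k * (a / k) := by
  have h1 : 0 < a / k := Nat.div_pos h hk
  have h2 := Nat.div_add_mod a k
  have h3 := Nat.mod_lt a hk
  nlinarith

lemma mixture_toOuterMeasure_le {α : Type} (p : unitInterval) (μ ν : PMF α) (s : Set α) {x : ℝ≥0∞}
    (hμ : μ.toOuterMeasure s ≤ x) (hν : ν.toOuterMeasure s ≤ x) :
    (mixture p μ ν).toOuterMeasure s ≤ x := by
  have h : (mixture p μ ν).toOuterMeasure s =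
      ENNReal.ofReal p * μ.toOuterMeasure s + ENNReal.ofReal (1 - p) * ν.toOuterMeasure s := by
    rw [PMF.toOuterMeasure_apply, PMF.toOuterMeasure_apply, PMF.toOuterMeasure_apply,
      ← ENNReal.tsum_mul_left, ← ENNReal.tsum_mul_left, ← ENNReal.tsum_add]
    congr 1
    ext a
    by_cases ha : a ∈ s
    · simp only [ha, Set.indicator_of_mem]; rfl
    · simp [ha]
  rw [h]
  calc _ ≤ ENNReal.ofReal p * x + ENNReal.ofReal (1 - p) * x := by gcongr
    _ = x := by
      rw [← add_mul, ← ENNReal.ofReal_add p.2.1 (sub_nonneg.2 p.2.2)]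
      simp

lemma randomClause_confined_le {k n c : ℕ} (h : Admissible k n c) (p : unitInterval)
    (f : Communities n c) (W : Finset (Fin n)) :
    (randomClause h p f).toOuterMeasure {C | vars C ⊆ W} ≤
      ENNReal.ofReal (confinementBound k n c W.card) := by
  have hk : 0 < k := by have := h.two_le; omega
  have hc : 0 < c := by have := h.le_c; omega
  have hn : 0 < n := lt_of_lt_of_le (Nat.mul_pos hc hk) h.le_n
  have hkN : k ≤ n / c := (Nat.le_div_iff_mul_le hc).2 (by rw [mul_comm]; exact h.le_n)
  have hN : ((n / c : ℕ) : ℝ) = n / c := Nat.cast_div h.dvd (by positivity)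
  have hk' : (0 : ℝ) < k := by exact_mod_cast hk
  have hc' : (0 : ℝ) < c := by exact_mod_cast hc
  have hn' : (0 : ℝ) < n := by exact_mod_cast hn
  have hx := confinementBound_nonneg k n c W.card
  have hck : (c : ℝ) ^ k = c ^ (k - 1) * c := by rw [← pow_succ]; congr 1; omega
  let _ : Fintype (WithinClause k f.1) := Fintype.ofFinite _
  let _ : Fintype (BridgeClause k f.1) := Fintype.ofFinite _
  have := h.nonempty_within f
  have := h.nonempty_bridge f
  refine mixture_toOuterMeasure_le p _ _ _ ?_ ?_
  · refine uniform_confined_le (fun C hC => hC.1) W hx ?_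
    have h1 : (c : ℝ) * ((n / c / k : ℕ) : ℝ) ^ k ≤ Nat.card (WithinClause k f.1) := by
      exact_mod_cast card_within_ge hk f
    have h2 : (n : ℝ) / (2 * k * c) ≤ ((n / c / k : ℕ) : ℝ) := by
      have : ((n / c : ℕ) : ℝ) ≤ 2 * k * ((n / c / k : ℕ) : ℝ) := by
        exact_mod_cast le_two_mul_mul_div hk hkN
      rw [hN, div_le_iff₀ hc'] at this
      rw [div_le_iff₀ (by positivity)]
      linarith
    calc ((2 * W.card : ℕ) : ℝ) ^ k
        = confinementBound k n c W.card * (c * ((n : ℝ) / (2 * k * c)) ^ k) := by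
          rw [confinementBound, div_pow (n : ℝ), mul_pow (2 * (k : ℝ)), hck, div_pow,
            div_mul_eq_mul_div]
          push_cast
          rw [show (4 * k * W.card : ℝ) = 2 * k * (2 * W.card) by ring, mul_pow (2 * k : ℝ)]
          field_simp
      _ ≤ confinementBound k n c W.card * (c * ((n / c / k : ℕ) : ℝ) ^ k) := by gcongr
      _ ≤ _ := by gcongr
  · refine uniform_confined_le (fun C hC => hC.1) W hx ?_
    have h1 : ((c / k : ℕ) * (n / c : ℕ) : ℝ) ^ k ≤ Nat.card (BridgeClause k f.1) := by
      exact_mod_cast card_bridge_ge hk f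
    have h2 : (n : ℝ) / (2 * k) ≤ (c / k : ℕ) * (n / c : ℕ) := by
      have : (c : ℝ) ≤ 2 * k * ((c / k : ℕ) : ℝ) := by
        exact_mod_cast le_two_mul_mul_div hk h.le_c
      rw [hN, div_le_iff₀ (by positivity)]
      calc (n : ℝ) = c * (n / c) := by field_simp
        _ ≤ 2 * k * ((c / k : ℕ) : ℝ) * (n / c) := by gcongr
        _ = _ := by ring
    have hc1 : (1 : ℝ) ≤ c ^ (k - 1) := one_le_pow₀ (by exact_mod_cast hc)
    calc ((2 * W.card : ℕ) : ℝ) ^ k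
        = (4 * k * W.card / n : ℝ) ^ k * 1 * ((n : ℝ) / (2 * k)) ^ k := by
          rw [mul_one, ← mul_pow]
          congr 1
          push_cast
          field_simp
          ring
      _ ≤ confinementBound k n c W.card * ((n : ℝ) / (2 * k)) ^ k := by
          rw [confinementBound]; gcongr
      _ ≤ confinementBound k n c W.card * ((c / k : ℕ) * (n / c : ℕ)) ^ k := by gcongr
      _ ≤ _ := by gcongr

lemma randomClause_not_card_le {k n c : ℕ} (h : Admissible k n c) (p : unitInterval)
    (f : Communities n c) : (randomClause h p f).toOuterMeasure {C | ¬ C.card ≤ k} = 0 := by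
  refine le_antisymm (mixture_toOuterMeasure_le p _ _ _ ?_ ?_) (zero_le) <;>
  · rw [PMF.toOuterMeasure_map_apply]
    refine (MeasureTheory.measure_mono (t := ∅) ?_).trans (by simp)
    intro C hC
    exact hC C.2.1.1.le

/-! ### Independent clauses -/

lemma iid_toOuterMeasure {α : Type} [Fintype α] (μ : PMF α) (m : ℕ) (I : Finset (Fin m))
    (A : Set α) :
    (iid μ m).toOuterMeasure {φ | ∀ j ∈ I, φ j ∈ A} = μ.toOuterMeasure A ^ I.card := by
  classical
  have h1 : ∀ j : Fin m, ∑ a, (if j ∈ I → a ∈ A then μ a else 0) =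
      if j ∈ I then μ.toOuterMeasure A else 1 := by
    intro j
    by_cases hj : j ∈ I
    · simp only [hj, forall_const, if_true]
      rw [PMF.toOuterMeasure_apply_fintype]
      exact Finset.sum_congr rfl fun a _ => by simp [Set.indicator_apply]
    · simp only [hj, false_imp_iff, if_true, if_false]
      rw [← tsum_fintype (L := .unconditional α)]; exact μ.tsum_coe
  rw [PMF.toOuterMeasure_apply_fintype]
  calc _ = ∑ φ : Fin m → α, ∏ j, (if j ∈ I → φ j ∈ A then μ (φ j) else 0) := by
        refine Finset.sum_congr rfl fun φ _ => ?_
        by_cases hφ : ∀ j ∈ I, φ j ∈ A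
        · rw [Set.indicator_of_mem (s := {φ : Fin m → α | ∀ j ∈ I, φ j ∈ A}) hφ]
          change ∏ j, μ (φ j) = _
          exact Finset.prod_congr rfl fun j _ => (if_pos (hφ j)).symm
        · rw [Set.indicator_of_notMem (s := {φ : Fin m → α | ∀ j ∈ I, φ j ∈ A}) hφ]
          push Not at hφ
          obtain ⟨j, hj, hjA⟩ := hφ
          exact (Finset.prod_eq_zero (Finset.mem_univ j) (by simp [hj, hjA])).symm
    _ = ∏ j, ∑ a, (if j ∈ I → a ∈ A then μ a else 0) := 
        (Fintype.prod_sum fun (j : Fin m) a => if j ∈ I → a ∈ A then μ a else 0).symm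
    _ = μ.toOuterMeasure A ^ I.card := by
        simp only [h1]
        rw [Finset.prod_ite, Finset.prod_const, Finset.prod_const_one, mul_one]
        simp

/-- The integer part of `(k / 2 + 1 / 40) * s`. If `s` clauses with at most `k` literals have a
boundary of less than `s / 20` variables, then they have at most this many variables in total. -/
def confinementSize (k s : ℕ) : ℕ := (20 * k + 1) * s / 40

lemma confinementSize_le {k : ℕ} (hk : 1 ≤ k) (s : ℕ) : confinementSize k s ≤ k * s := by
  rw [confinementSize]
  exact Nat.div_le_of_le_mul (by nlinarith)

lemma exists_confined_of_not_boundaryExpanding {n m k r : ℕ} {φ : Fin m → Clause (Fin n)}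
    (hk : 1 ≤ k) (hr : k * r ≤ n) (hφk : ∀ j, (φ j).card ≤ k) (hφ : ¬ BoundaryExpanding φ r) :
    ∃ s ∈ Finset.Icc 1 r, ∃ I ∈ Finset.powersetCard s (Finset.univ : Finset (Fin m)),
      ∃ W ∈ Finset.powersetCard (confinementSize k s) (Finset.univ : Finset (Fin n)),
        ∀ j ∈ I, vars (φ j) ⊆ W := by
  simp only [BoundaryExpanding, not_forall, not_le] at hφ
  obtain ⟨I, hI, hbd⟩ := hφ
  have h1 := two_mul_card_varsOf_le hφk I
  have h2 : (varsOf φ I).card ≤ confinementSize k I.card := by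
    rw [confinementSize, Nat.le_div_iff_mul_le (by norm_num)]
    nlinarith
  have h3 : confinementSize k I.card ≤ Fintype.card (Fin n) := by
    rw [Fintype.card_fin]
    exact (confinementSize_le hk _).trans ((Nat.mul_le_mul_left k hI).trans hr)
  obtain ⟨W, hW, hWc⟩ := Finset.exists_superset_card_eq h2 h3
  refine ⟨I.card, Finset.mem_Icc.2 ⟨by omega, hI⟩, I, by simp [Finset.mem_powersetCard], W,
    by simp [Finset.mem_powersetCard, hWc], fun j hj => ?_⟩
  exact (Finset.subset_biUnion_of_mem (fun i => vars (φ i)) hj).trans hW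

lemma iid_not_boundaryExpanding_le {k n c : ℕ} (h : Admissible k n c) (p : unitInterval)
    (f : Communities n c) (m r : ℕ) (hr : k * r ≤ n) :
    (iid (randomClause h p f) m).toOuterMeasure
        {φ | ¬ (BoundaryExpanding φ r ∧ ∀ j, (φ j).card ≤ k)} ≤
      ∑ s ∈ Finset.Icc 1 r, ENNReal.ofReal (m.choose s * n.choose (confinementSize k s) *
        confinementBound k n c (confinementSize k s) ^ s) := by
  have hk : 1 ≤ k := by have := h.two_le; omega
  set P := (iid (randomClause h p f) m).toOuterMeasure
  set E : Finset (Fin m) → Finset (Fin n) → Set (Fin m → Clause (Fin n)) :=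
    fun I W => {φ | ∀ j ∈ I, φ j ∈ {C : Clause (Fin n) | vars C ⊆ W}}
  have hsub : {φ : Fin m → Clause (Fin n) | ¬ (BoundaryExpanding φ r ∧ ∀ j, (φ j).card ≤ k)} ⊆
      (⋃ j ∈ (Finset.univ : Finset (Fin m)),
        {φ | ∀ i ∈ ({j} : Finset (Fin m)), φ i ∈ {C : Clause (Fin n) | ¬ C.card ≤ k}}) ∪
      ⋃ s ∈ Finset.Icc 1 r, ⋃ I ∈ Finset.powersetCard s Finset.univ,
        ⋃ W ∈ Finset.powersetCard (confinementSize k s) Finset.univ, E I W := by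
    intro φ hφ
    by_cases hφk : ∀ j, (φ j).card ≤ k
    · right
      obtain ⟨s, hs, I, hI, W, hW, hE⟩ := exists_confined_of_not_boundaryExpanding hk hr hφk
        fun he => hφ ⟨he, hφk⟩
      exact Set.mem_biUnion hs (Set.mem_biUnion hI (Set.mem_biUnion hW hE))
    · left
      push Not at hφk
      obtain ⟨j, hj⟩ := hφk
      exact Set.mem_biUnion (Finset.mem_univ j) (by simpa using hj)
  refine (MeasureTheory.measure_mono hsub).trans ((MeasureTheory.measure_union_le _ _).trans ?_)
  have h0 : P (⋃ j ∈ (Finset.univ : Finset (Fin m)),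
      {φ | ∀ i ∈ ({j} : Finset (Fin m)), φ i ∈ {C : Clause (Fin n) | ¬ C.card ≤ k}}) = 0 := by
    refine le_antisymm ((MeasureTheory.measure_biUnion_finset_le _ _).trans ?_) zero_le
    refine (Finset.sum_eq_zero fun j _ => ?_).le
    rw [iid_toOuterMeasure, randomClause_not_card_le]
    simp
  rw [h0, zero_add]
  refine (MeasureTheory.measure_biUnion_finset_le _ _).trans (Finset.sum_le_sum fun s _ => ?_)
  have hE : ∀ I ∈ Finset.powersetCard s (Finset.univ : Finset (Fin m)),
      ∀ W ∈ Finset.powersetCard (confinementSize k s) (Finset.univ : Finset (Fin n)),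
      P (E I W) ≤ ENNReal.ofReal (confinementBound k n c (confinementSize k s) ^ s) := by
    intro I hI W hW
    rw [iid_toOuterMeasure, (Finset.mem_powersetCard.1 hI).2,
      ENNReal.ofReal_pow (confinementBound_nonneg _ _ _ _), ← (Finset.mem_powersetCard.1 hW).2]
    gcongr
    exact randomClause_confined_le h p f W
  calc _ ≤ ∑ I ∈ Finset.powersetCard s (Finset.univ : Finset (Fin m)),
        ∑ W ∈ Finset.powersetCard (confinementSize k s) (Finset.univ : Finset (Fin n)),
          ENNReal.ofReal (confinementBound k n c (confinementSize k s) ^ s) :=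
        (MeasureTheory.measure_biUnion_finset_le _ _).trans (Finset.sum_le_sum fun I hI =>
          (MeasureTheory.measure_biUnion_finset_le _ _).trans (Finset.sum_le_sum fun W hW =>
            hE I hI W hW))
    _ = _ := by
      rw [Finset.sum_const, Finset.sum_const, Finset.card_powersetCard, Finset.card_powersetCard,
        Finset.card_univ, Finset.card_univ, Fintype.card_fin, Fintype.card_fin, nsmul_eq_mul,
        nsmul_eq_mul, ← mul_assoc, ENNReal.ofReal_mul (by positivity),
        ENNReal.ofReal_mul (by positivity), ENNReal.ofReal_natCast, ENNReal.ofReal_natCast]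

/-- The union bound over all small sets of clauses and all sets of variables in which they might be
confined. -/
theorem communityAttachment_not_boundaryExpanding_le {k n c : ℕ} (h : Admissible k n c) (m r : ℕ)
    (p : unitInterval) (hr : k * r ≤ n) :
    (communityAttachment h m p).toOuterMeasure
        {φ | ¬ (BoundaryExpanding φ r ∧ ∀ j, (φ j).card ≤ k)} ≤
      ∑ s ∈ Finset.Icc 1 r, ENNReal.ofReal (m.choose s * n.choose (confinementSize k s) *
        confinementBound k n c (confinementSize k s) ^ s) := by
  rw [communityAttachment, PMF.toOuterMeasure_bind_apply]
  refine (ENNReal.tsum_le_tsum fun f => mul_le_mul_right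
    (iid_not_boundaryExpanding_le h p f m r hr) _).trans ?_
  rw [ENNReal.tsum_mul_right, PMF.tsum_coe, one_mul]

/-! ### Asymptotics -/

lemma choose_le_exp_mul_div_pow (n s : ℕ) : (n.choose s : ℝ) ≤ (Real.exp 1 * n / s) ^ s := by
  rcases Nat.eq_zero_or_pos s with rfl | hs
  · simp
  have hs' : (0 : ℝ) < s := by exact_mod_cast hs
  have h1 := Nat.choose_le_pow_div (α := ℝ) s n
  have h2 : (s : ℝ) ^ s / s.factorial ≤ Real.exp 1 ^ s := by
    rw [← Real.exp_nat_mul, mul_one]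
    exact Real.pow_div_factorial_le_exp s hs'.le s
  have hf : (0 : ℝ) < s.factorial := by exact_mod_cast s.factorial_pos
  rw [div_le_iff₀ hf] at h2
  refine h1.trans ?_
  rw [div_pow, mul_pow, div_le_div_iff₀ hf (by positivity)]
  calc (n : ℝ) ^ s * s ^ s ≤ n ^ s * (Real.exp 1 ^ s * s.factorial) := by gcongr
    _ = _ := by ring

lemma le_confinementSize {k : ℕ} (hk : 2 ≤ k) (s : ℕ) : s ≤ confinementSize k s := by
  rw [confinementSize, Nat.le_div_iff_mul_le (by norm_num)]
  nlinarith

/-- The contribution of the sets of `s` clauses to the union bound. With `t = n / s`, its `s`-th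
root is at most a constant times `t ^ (41 / 40 - k / 2) * n ^ ((k - 1) / 10)`, and `t` is at least
`n ^ (9 / 20)`; for `k ≥ 3` the exponent of `n` is then at most `-1 / 100`. -/
lemma exists_union_bound {k : ℕ} (hk : 3 ≤ k) {M D : ℝ} (hM : 0 < M) (hD : 0 < D) :
    ∃ K : ℝ, 0 < K ∧ ∀ n m c s : ℕ, 1 ≤ s → 1 ≤ n → (s : ℝ) ≤ (n : ℝ) ^ (11 / 20 : ℝ) →
      (m : ℝ) ≤ M * n → (c : ℝ) ≤ D * (n : ℝ) ^ (1 / 10 : ℝ) →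
      (m.choose s * n.choose (confinementSize k s) *
        confinementBound k n c (confinementSize k s) ^ s : ℝ) ≤
        (K * (n : ℝ) ^ (-(1 / 100) : ℝ)) ^ s := by
  set θ : ℝ := (20 * k + 1) / 40 with hθ
  refine ⟨Real.exp 1 * M * Real.exp 1 ^ θ * (4 * k ^ 2) ^ k * D ^ (k - 1), by positivity, ?_⟩
  intro n m c s hs hn hsn hmn hcn
  have hk0 : (3 : ℝ) ≤ k := by exact_mod_cast hk
  have hs0 : (0 : ℝ) < s := by exact_mod_cast hs
  have hn0 : (0 : ℝ) < n := by exact_mod_cast hn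
  have hn1 : (1 : ℝ) ≤ n := by exact_mod_cast hn
  set v := confinementSize k s with hv
  have hsv : (s : ℝ) ≤ v := by exact_mod_cast le_confinementSize (by omega) s
  have hvk : (v : ℝ) ≤ k * s := by exact_mod_cast confinementSize_le (by omega) s
  have hvθ : (v : ℝ) ≤ θ * s := by
    have : ((v * 40 : ℕ) : ℝ) ≤ ((20 * k + 1) * s : ℕ) := by
      exact_mod_cast Nat.div_mul_le_self _ _
    push_cast at this
    rw [hθ]
    linarith
  set t : ℝ := n / s with ht
  have hst : (n : ℝ) ^ (9 / 20 : ℝ) ≤ t := by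
    rw [ht, le_div_iff₀ hs0]
    calc (n : ℝ) ^ (9 / 20 : ℝ) * s ≤ (n : ℝ) ^ (9 / 20 : ℝ) * (n : ℝ) ^ (11 / 20 : ℝ) := by gcongr
      _ = n := by rw [← Real.rpow_add hn0]; norm_num
  have ht0 : 0 < t := by positivity
  have ht1 : 1 ≤ t := (Real.one_le_rpow hn1 (by norm_num)).trans hst
  have he1 : 1 ≤ Real.exp 1 := Real.one_le_exp zero_le_one
  have h1 : (m.choose s : ℝ) ≤ (Real.exp 1 * M * t) ^ s := by
    refine (choose_le_exp_mul_div_pow m s).trans ?_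
    gcongr
    calc Real.exp 1 * m / s ≤ Real.exp 1 * (M * n) / s := by gcongr
      _ = _ := by rw [ht]; ring
  have h2 : (n.choose v : ℝ) ≤ ((Real.exp 1 * t) ^ θ) ^ s := by
    calc (n.choose v : ℝ) ≤ (Real.exp 1 * n / v) ^ v := choose_le_exp_mul_div_pow n v
      _ ≤ (Real.exp 1 * t) ^ v := by
        gcongr
        calc Real.exp 1 * n / v ≤ Real.exp 1 * n / s := by gcongr
          _ = _ := by rw [ht]; ring
      _ = (Real.exp 1 * t) ^ (v : ℝ) := (Real.rpow_natCast _ _).symm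
      _ ≤ (Real.exp 1 * t) ^ (θ * s) :=
        Real.rpow_le_rpow_of_exponent_le (one_le_mul_of_one_le_of_one_le he1 ht1) hvθ
      _ = _ := by rw [Real.rpow_mul (by positivity), Real.rpow_natCast]
  have h3 : confinementBound k n c v ≤
      (4 * k ^ 2 * t⁻¹) ^ k * (D * (n : ℝ) ^ (1 / 10 : ℝ)) ^ (k - 1) := by
    rw [confinementBound]
    gcongr
    calc (4 * k * v / n : ℝ) ≤ 4 * k * (k * s) / n := by gcongr
      _ = _ := by rw [ht, inv_div]; ring
  have h4 : t * t ^ θ * (t⁻¹) ^ k * ((n : ℝ) ^ (1 / 10 : ℝ)) ^ (k - 1) ≤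
      (n : ℝ) ^ (-(1 / 100) : ℝ) := by
    have e1 : t * t ^ θ * (t⁻¹) ^ k = t ^ (1 + θ - k) := by
      rw [Real.rpow_sub ht0, Real.rpow_add ht0, Real.rpow_one, Real.rpow_natCast, inv_pow,
        div_eq_mul_inv]
    have e2 : ((n : ℝ) ^ (1 / 10 : ℝ)) ^ (k - 1) = (n : ℝ) ^ ((1 / 10 : ℝ) * (k - 1)) := by
      rw [← Real.rpow_natCast, ← Real.rpow_mul hn0.le, Nat.cast_sub (by omega), Nat.cast_one]
    have hneg : 1 + θ - k ≤ 0 := by rw [hθ]; linarith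
    rw [e1, e2]
    calc t ^ (1 + θ - k) * (n : ℝ) ^ ((1 / 10 : ℝ) * (k - 1))
        ≤ ((n : ℝ) ^ (9 / 20 : ℝ)) ^ (1 + θ - k) * (n : ℝ) ^ ((1 / 10 : ℝ) * (k - 1)) := by
          gcongr ?_ * _
          exact Real.rpow_le_rpow_of_nonpos (by positivity) hst hneg
      _ = (n : ℝ) ^ ((9 / 20 : ℝ) * (1 + θ - k) + (1 / 10 : ℝ) * (k - 1)) := by
          rw [← Real.rpow_mul hn0.le, ← Real.rpow_add hn0]
      _ ≤ _ := Real.rpow_le_rpow_of_exponent_le hn1 (by rw [hθ]; linarith)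
  calc (m.choose s * n.choose v * confinementBound k n c v ^ s : ℝ)
      ≤ (Real.exp 1 * M * t) ^ s * ((Real.exp 1 * t) ^ θ) ^ s *
        ((4 * k ^ 2 * t⁻¹) ^ k * (D * (n : ℝ) ^ (1 / 10 : ℝ)) ^ (k - 1)) ^ s := by
        have := confinementBound_nonneg k n c v
        gcongr
    _ = (Real.exp 1 * M * Real.exp 1 ^ θ * (4 * k ^ 2) ^ k * D ^ (k - 1) *
        (t * t ^ θ * (t⁻¹) ^ k * ((n : ℝ) ^ (1 / 10 : ℝ)) ^ (k - 1))) ^ s := by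
        rw [← mul_pow, ← mul_pow, Real.mul_rpow (Real.exp_pos 1).le ht0.le, mul_pow (4 * (k : ℝ) ^ 2),
          mul_pow D]
        ring
    _ ≤ _ := by gcongr

lemma sum_ofReal_pow_le {x : ℝ} (hx0 : 0 ≤ x) (hx : x ≤ 1 / 2) (r : ℕ) :
    ∑ s ∈ Finset.Icc 1 r, ENNReal.ofReal (x ^ s) ≤ ENNReal.ofReal (2 * x) := by
  rw [← ENNReal.ofReal_sum_of_nonneg fun s _ => by positivity]
  apply ENNReal.ofReal_le_ofReal
  have h := geom_sum_Ico_le_of_lt_one (m := 1) (n := r + 1) hx0 (by linarith)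
  rw [pow_one] at h
  refine h.trans ?_
  rw [div_le_iff₀ (by linarith)]
  nlinarith

lemma toOuterMeasure_le_one {α : Type} (μ : PMF α) (s : Set α) : μ.toOuterMeasure s ≤ 1 := by
  rw [PMF.toOuterMeasure_apply, ← μ.tsum_coe]
  exact ENNReal.tsum_le_tsum fun a => Set.indicator_le_self' (fun _ _ => zero_le) a

/-- If `U` has probability bounded away from zero and `U \ H` has vanishing probability, then the
conditional probability of `H` given `U` tends to one. -/
lemma tendsto_conditional {Ω : ℕ → Type} (P : ∀ i, PMF (Ω i)) (U H : ∀ i, Set (Ω i)) {δ : ℝ≥0∞}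
    (hδ : 0 < δ) (hU : ∀ᶠ i in Filter.atTop, δ ≤ (P i).toOuterMeasure (U i))
    (h : Filter.Tendsto (fun i => (P i).toOuterMeasure (U i \ H i)) Filter.atTop (nhds 0)) :
    Filter.Tendsto
      (fun i => (P i).toOuterMeasure (U i ∩ H i) / (P i).toOuterMeasure (U i))
      Filter.atTop (nhds 1) := by
  have h1 : Filter.Tendsto (fun i => 1 - (P i).toOuterMeasure (U i \ H i) / δ) Filter.atTop
      (nhds 1) := by
    have := ENNReal.Tendsto.sub (tendsto_const_nhds (x := (1 : ℝ≥0∞)))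
      (ENNReal.Tendsto.div_const h (.inr hδ.ne')) (.inl ENNReal.one_ne_top)
    simpa using this
  refine tendsto_of_tendsto_of_tendsto_of_le_of_le' h1 tendsto_const_nhds ?_ ?_
  · filter_upwards [hU] with i hi
    have hne : (P i).toOuterMeasure (U i) ≠ 0 := (hδ.trans_le hi).ne'
    have hnt : (P i).toOuterMeasure (U i) ≠ ⊤ :=
      ne_top_of_le_ne_top ENNReal.one_ne_top (toOuterMeasure_le_one _ _)
    rw [tsub_le_iff_right, ← ENNReal.div_self hne hnt]
    calc (P i).toOuterMeasure (U i) / (P i).toOuterMeasure (U i)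
        ≤ ((P i).toOuterMeasure (U i ∩ H i) + (P i).toOuterMeasure (U i \ H i)) /
          (P i).toOuterMeasure (U i) := by
          gcongr
          exact MeasureTheory.measure_le_inter_add_sdiff _ _ _
      _ = _ := ENNReal.add_div
      _ ≤ _ := by gcongr
  · filter_upwards with i
    exact ENNReal.div_le_of_le_mul (by
      rw [one_mul]; exact MeasureTheory.measure_mono Set.inter_subset_left)

/-- For large `n`, expansion up to `n ^ (11 / 20)` clauses gives the runtime `2 ^ (n ^ (1 / 20))`:
the exponent is of order `(n ^ (11 / 20)) ^ 2 / n = n ^ (1 / 10)`. -/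
lemma eventually_two_mul_rpow_le (k : ℕ) :
    ∀ᶠ n : ℕ in Filter.atTop, k * ⌊(n : ℝ) ^ (11 / 20 : ℝ)⌋₊ ≤ n ∧
      2 ≤ ⌊(n : ℝ) ^ (11 / 20 : ℝ)⌋₊ ∧ k ≤ ⌊(n : ℝ) ^ (11 / 20 : ℝ)⌋₊ / 80 ∧
      2 * (2 : ℝ) ^ ((n : ℝ) ^ (1 / 20 : ℝ)) ≤
        Real.exp ((⌊(n : ℝ) ^ (11 / 20 : ℝ)⌋₊ / 80 : ℕ) *
          ((⌊(n : ℝ) ^ (11 / 20 : ℝ)⌋₊ / 80 : ℕ) / (2 * n))) := by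
  have hlim : ∀ a : ℝ, 0 < a → Filter.Tendsto (fun n : ℕ => (n : ℝ) ^ a) Filter.atTop
      Filter.atTop := fun a ha => (tendsto_rpow_atTop ha).comp tendsto_natCast_atTop_atTop
  filter_upwards [(hlim (11 / 20) (by norm_num)).eventually_ge_atTop (80 * k + 162),
    (hlim (9 / 20) (by norm_num)).eventually_ge_atTop k,
    (hlim (1 / 20) (by norm_num)).eventually_ge_atTop 100000,
    Filter.eventually_ge_atTop 1] with n h1 h2 h3 hn
  have hn0 : (0 : ℝ) < n := by exact_mod_cast hn
  set x := (n : ℝ) ^ (11 / 20 : ℝ) with hx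
  set y := (n : ℝ) ^ (1 / 20 : ℝ) with hy
  set r := ⌊x⌋₊ with hr
  have hx0 : 0 < x := by positivity
  have hrx : (r : ℝ) ≤ x := Nat.floor_le hx0.le
  have hxr : 80 * k + 162 ≤ r := Nat.le_floor (by push_cast; exact h1)
  refine ⟨?_, by omega, by omega, ?_⟩
  · have : (k : ℝ) * r ≤ n := by
      calc (k : ℝ) * r ≤ (n : ℝ) ^ (9 / 20 : ℝ) * x := by gcongr
        _ = n := by rw [hx, ← Real.rpow_add hn0]; norm_num
    exact_mod_cast this
  · have hd : x / 160 ≤ (r / 80 : ℕ) := by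
      have e1 : x < r + 1 := Nat.lt_floor_add_one x
      have e2 : r < 80 * (r / 80) + 80 := by omega
      have e2' : (r : ℝ) < 80 * (r / 80 : ℕ) + 80 := by exact_mod_cast e2
      have e3 : (162 : ℝ) ≤ x := by linarith [(Nat.cast_nonneg k : (0 : ℝ) ≤ k)]
      linarith
    have hxy : x * x = n * (y * y) := by
      rw [hx, hy, ← Real.rpow_add hn0, ← Real.rpow_add hn0, ← Real.rpow_one_add' hn0.le (by norm_num)]
      norm_num
    calc 2 * (2 : ℝ) ^ y = (2 : ℝ) ^ (1 + y) := by
          rw [Real.rpow_add two_pos, Real.rpow_one]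
      _ ≤ Real.exp 1 ^ (1 + y) := by
          gcongr
          linarith [Real.add_one_le_exp 1]
      _ = Real.exp (1 + y) := by rw [← Real.exp_mul, one_mul]
      _ ≤ _ := by
        apply Real.exp_le_exp.2
        -- `51200 = 2 * 160 ^ 2`
        calc 1 + y ≤ y * y / 51200 := by nlinarith
          _ = (x / 160) * ((x / 160) / (2 * n)) := by
            field_simp
            linarith
          _ ≤ _ := by gcongr

/-- Large formulas of the model are expanding, hence hard, with high probability. -/
lemma tendsto_unsatEvent_diff_hardEvent {k : ℕ} (hk : 3 ≤ k) {n m c : ℕ → ℕ} (p : ℕ → unitInterval)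
    (h : ∀ i, Admissible k (n i) (c i)) (hn : Filter.Tendsto n Filter.atTop Filter.atTop)
    (hm : (fun i => (m i : ℝ)) =O[Filter.atTop] (fun i => (n i : ℝ)))
    (hc : (fun i => (c i : ℝ)) =O[Filter.atTop] (fun i => (n i : ℝ) ^ (1 / 10 : ℝ))) :
    Filter.Tendsto
      (fun i => (communityAttachment (h i) (m i) (p i)).toOuterMeasure
        (unsatEvent (n i) (m i) \ hardEvent (n i) (m i) ((2 : ℝ) ^ ((n i : ℝ) ^ (1 / 20 : ℝ)))))
      Filter.atTop (nhds 0) := by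
  obtain ⟨M, hM, hmM⟩ := hm.exists_pos
  obtain ⟨D, hD, hcD⟩ := hc.exists_pos
  obtain ⟨K, hK, hbound⟩ := exists_union_bound hk hM hD
  have hx : Filter.Tendsto (fun i => K * (n i : ℝ) ^ (-(1 / 100) : ℝ)) Filter.atTop (nhds 0) := by
    have := ((tendsto_rpow_neg_atTop (y := 1 / 100) (by norm_num)).comp
      (tendsto_natCast_atTop_atTop.comp hn)).const_mul K
    simpa using this
  have hlim : Filter.Tendsto
      (fun i => ENNReal.ofReal (2 * (K * (n i : ℝ) ^ (-(1 / 100) : ℝ)))) Filter.atTop (nhds 0) := by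
    have := ENNReal.tendsto_ofReal (hx.const_mul 2)
    simpa using this
  refine tendsto_of_tendsto_of_tendsto_of_le_of_le' tendsto_const_nhds hlim
    (Filter.Eventually.of_forall fun i => zero_le) ?_
  filter_upwards [hmM.bound, hcD.bound, hn.eventually (eventually_two_mul_rpow_le k),
    hn.eventually_ge_atTop 1, hx.eventually_le_const (by norm_num : (0 : ℝ) < 1 / 2)] with
    i hmi hci ⟨hr1, hr2, hr3, hr4⟩ hni hxi
  rw [Real.norm_natCast, Real.norm_natCast] at hmi
  rw [Real.norm_natCast, Real.norm_of_nonneg (by positivity)] at hci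
  set r := ⌊(n i : ℝ) ^ (11 / 20 : ℝ)⌋₊
  calc _ ≤ (communityAttachment (h i) (m i) (p i)).toOuterMeasure
        {φ | ¬ (BoundaryExpanding φ r ∧ ∀ j, (φ j).card ≤ k)} := by
        refine MeasureTheory.measure_mono ?_
        rintro φ ⟨-, hφ⟩ ⟨hexp, hcard⟩
        exact hφ (hexp.le_runtime hr2 (Nat.mul_div_le r 80) hr3 hcard hr4)
    _ ≤ _ := communityAttachment_not_boundaryExpanding_le (h i) (m i) r (p i) hr1
    _ ≤ ∑ s ∈ Finset.Icc 1 r,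
        ENNReal.ofReal ((K * (n i : ℝ) ^ (-(1 / 100) : ℝ)) ^ s) := by
        refine Finset.sum_le_sum fun s hs => ENNReal.ofReal_le_ofReal ?_
        rw [Finset.mem_Icc] at hs
        refine hbound _ _ _ _ hs.1 hni ?_ hmi hci
        exact (Nat.cast_le.2 hs.2).trans (Nat.floor_le (by positivity))
    _ ≤ _ := sum_ofReal_pow_le (by positivity) hxi r

end CommunitySAT

/-- For `k ≥ 3` and `α < 1/10` there is `λ > 0` such that, for all admissible parameters with
`n → ∞`, `m = O(n)` and `c = O(n ^ α)`, a random formula of the community attachment model is with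
high probability not an unsatisfiable formula on which some CDCL solver takes fewer than
`2 ^ (n ^ λ)` steps; and if the probability of being unsatisfiable is bounded away from zero, then conditionally on
unsatisfiability every CDCL solver makes at least `2 ^ (n ^ λ)` steps with high probability. -/
theorem mainTheorem1 (k : ℕ) (hk : 3 ≤ k) (α : ℝ) (hα : α < 1 / 10) :
    ∃ lam : ℝ, 0 < lam ∧
      ∀ (n m c : ℕ → ℕ) (p : ℕ → unitInterval)
        (h : ∀ i, CommunitySAT.Admissible k (n i) (c i)),
        Filter.Tendsto n Filter.atTop Filter.atTop →
        (fun i => (m i : ℝ)) =O[Filter.atTop] (fun i => (n i : ℝ)) →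
        (fun i => (c i : ℝ)) =O[Filter.atTop] (fun i => (n i : ℝ) ^ α) →
        Filter.Tendsto
          (fun i => (CommunitySAT.communityAttachment (h i) (m i) (p i)).toOuterMeasure
            (CommunitySAT.unsatEvent (n i) (m i) \
              CommunitySAT.hardEvent (n i) (m i) ((2 : ℝ) ^ ((n i : ℝ) ^ lam))))
          Filter.atTop (nhds 0) ∧
        ((∃ δ : ENNReal, 0 < δ ∧ ∀ᶠ i in Filter.atTop,
            δ ≤ (CommunitySAT.communityAttachment (h i) (m i) (p i)).toOuterMeasure
              (CommunitySAT.unsatEvent (n i) (m i))) →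
          Filter.Tendsto
            (fun i =>
              (CommunitySAT.communityAttachment (h i) (m i) (p i)).toOuterMeasure
                  (CommunitySAT.unsatEvent (n i) (m i) ∩
                    CommunitySAT.hardEvent (n i) (m i) ((2 : ℝ) ^ ((n i : ℝ) ^ lam))) /
                (CommunitySAT.communityAttachment (h i) (m i) (p i)).toOuterMeasure
                  (CommunitySAT.unsatEvent (n i) (m i)))
            Filter.atTop (nhds 1)) := by
  refine ⟨1 / 20, by norm_num, fun n m c p h hn hm hc => ?_⟩
  have hc' : (fun i => (c i : ℝ)) =O[Filter.atTop] (fun i => (n i : ℝ) ^ (1 / 10 : ℝ)) := by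
    refine hc.trans (Asymptotics.IsBigO.of_bound 1 ?_)
    filter_upwards [hn.eventually_ge_atTop 1] with i hi
    rw [one_mul, Real.norm_of_nonneg (by positivity), Real.norm_of_nonneg (by positivity)]
    exact Real.rpow_le_rpow_of_exponent_le (by exact_mod_cast hi) hα.le
  have key := CommunitySAT.tendsto_unsatEvent_diff_hardEvent hk p h hn hm hc'
  refine ⟨key, ?_⟩
  rintro ⟨δ, hδ, hU⟩
  exact CommunitySAT.tendsto_conditional _ _ _ hδ hU key
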